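/- Conventions. A (real) Banach scale $X=\{X_s\}$ indexed by $\mathbb Z$, $\mathbb N_0$ or a subset consists of Banach spaces with injective continuous linear bonding maps $X_s\hookrightarrow X_r$ ($s>r$, functorial, compact) such that the projective limit $X_\infty$ is dense in every $X_s$; it is Banachable if the layers are only completely normable. $X_{\ge 0}$ is the restriction to $\mathbb N_0$, $X^1=\{X_{m+1}\}_m$ the shift, $X\times Y$ the layerwise product, and $X^*$ the dual scale, whose layer of index $s$ is $X_{-s}^*$, bonded by adjoints. For $U\subset X_0$ open put $U_m=U\cap X_m$. A map $f:U\to Y_0$ is $\mathrm{sc}^0$ if it restricts to continuous maps $U_m\to Y_m$ for all $m\ge0$; it is $\mathrm{sc}^1$ if moreover there is an $\mathrm{sc}^0$ map $Df:U^1\times X\to Y$, linear in the second argument, such that $f|_{U_1}:U_1\to Y_0$ is Fréchet differentiable at each $x\in U_1$ with derivative $Df(x,\cdot)|_{X_1}$; it is $\mathrm{sc}^{k+1}$ if in addition $Tf=(f,Df):U^1\times X\to Y^1\times Y$ is $\mathrm{sc}^k$, and sc-smooth ($\mathrm{sc}^\infty$) if it is $\mathrm{sc}^k$ for all $k$. An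 $\mathrm{sc}^\infty$-manifold modeled on $X$ is a Hausdorff space with a maximal atlas of charts onto open subsets of $X_0$ with sc-smooth transition maps; it has the filtration $M_m=\{p:\phi(p)\in X_m\}$ with the topologies induced by the charts into $X_m$, and $M^1$ denotes $M_1$ with the induced structure modeled on $X^1$, with charts $\phi_1=\phi|_{U_1}$. For $p\in M_{m+1}$ and $0\le k\le m$, $(T_pM)_k$ is the set of classes of pairs $(\phi,v)$, $\phi$ a chart around $p$ and $v\in X_k$, with $(\phi,v)\sim(\psi,D(\psi\phi^{-1})(\phi(p),v))$; it is isomorphic to $X_k$ via $(D_p\phi)_k$. The derivative of an sc-smooth map of manifolds is defined through charts, and the map is a submersion if every layer $(D_pf)_k$, $k\le m$, $p\in M_{m+1}$, is surjective. A symplectic structure on a Banach scale $X$ on $\mathbb Z$ is a family of continuous bilinear forms $\omega_s:X_s\times X_{-s}\to\mathbb R$ with $\omega_s(v,w)=-\omega_{-s}(w,v)$ such that $\iota_\omega:X_s\to X_{-s}^*$, $w\mapsto\omega_{-s}(\cdot,w)$, is an isomorphism of scales $X\cong X^*$. A symplectic $\mathrm{sc}^\infty$-manifold modeled on $(X,\omega)$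 is an $\mathrm{sc}^\infty$-manifold modeled on $X_{\ge0}$ with a maximal symplectic atlas, i.e. an atlas of charts of $M$ whose transition maps $f$ satisfy $\omega_0(D_xf\,v,D_xf\,w)=\omega_0(v,w)$ for all $x$ in layer $1$ and $v,w\in X_0$. For $p\in M_{m+1}$ the tangent scale extends to the indices $-m,\dots,m$ (to $\mathbb Z$ if $m=\infty$, where $M_\infty=\bigcap_mM_m$) by $(T_pM)_s:=(T_pM)_{-s}^*$ for $s<0$, with $(D_p\phi)_s:=\iota_\omega^{-1}\circ((D_p\phi)_{-s}^{-1})^*$ for a symplectic chart $\phi$ around $p$, and with the bonding maps pulled back from $X$ by $D_p\phi$. Proposition. Let $M$ be a symplectic $\mathrm{sc}^\infty$-manifold modeled on $(X,\omega)$, and let $T^*M=\bigcup_{p\in M_1}\{p\}\times(T_pM)_0^*$. Then: 1. $T^*M$ is an $\mathrm{sc}^\infty$-manifold modeled on $X_{\ge0}^1\times X^*$, where for every symplectic chart $\phi:U\to\phi(U)\subset X_0$ the map $T^*\phi:(p,\alpha)\mapsto(\phi(p),((D_p\phi)_0^{-1})^*\alpha)$ is a chart from $\bigcup_{p\in U_1}\{p\}\times(T_pM)_0^*$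 onto $\phi(U)_1\times X_0^*$. 2. Its filtration is $(T^*M)_m=\bigcup_{p\in M_{m+1}}\{p\}\times(T_pM)_{-m}^*$ for $m\in\mathbb N_0$, where $(T_pM)_{-m}^*\subset(T_pM)_0^*$ through the adjoint of the bonding map $(T_pM)_0\hookrightarrow(T_pM)_{-m}$ (for any choice of the symplectic chart around $p$). 3. The projection $\pi:T^*M\to M^1$, $(p,\alpha)\mapsto p$, is an sc-smooth submersion and is surjective, also as a map $(T^*M)_m\to(M^1)_m$ for every $m$. 4. For $p\in M_{m+1}$, $m\in\mathbb N_0\cup\{\infty\}$, the fiber $\pi^{-1}(p)=\{p\}\times(T_pM)_0^*$ carries the scale structure of the dual scale: the spaces $(T_pM)_{-k}^*$, $0\le k\le m$ ($k<\infty$), with the adjoint bonding maps form a Banachable scale; for each such $k$ the map $(T_pM)_{-k}^*\to(T^*M)_k$ is a topological embedding with image $\pi^{-1}(p)\cap(T^*M)_k$; and these maps are compatible with the bonding maps. -/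

import Mathlib

open Set Filter Topology

universe u v w

noncomputable section

/-! ## Banach scales -/

/-- A real Banach scale with index set `ι` (used for `ι = ℤ` and `ι = ℕ`): Banach spaces `X_s` with
continuous linear injective bonding maps `X_s → X_r` for `r ≤ s` (the identity for `r = s`), compact
for `r < s`, such that the projective limit `X_∞` (the compatible families) is dense in every
layer. -/
structure BanachScale (ι : Type) [Preorder ι] where
  layer : ι → Type u
  [normed : ∀ s, NormedAddCommGroup (layer s)]
  [space : ∀ s, NormedSpace ℝ (layer s)]
  [complete : ∀ s, CompleteSpace (layer s)]
  bond : ∀ {s r : ι}, r ≤ s → layer s →L[ℝ] layer r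
  bond_self : ∀ (s : ι) (x : layer s), bond (le_refl s) x = x
  bond_bond : ∀ {s r q : ι} (hr : r ≤ s) (hq : q ≤ r) (x : layer s),
    bond hq (bond hr x) = bond (hq.trans hr) x
  bond_injective : ∀ {s r : ι} (h : r ≤ s), Function.Injective (bond h)
  bond_compact : ∀ {s r : ι} (h : r < s), IsCompactOperator (bond h.le)
  limit_dense : ∀ s : ι, Dense {y : layer s | ∃ x : ∀ t, layer t,
    (∀ {t r : ι} (h : r ≤ t), bond h (x t) = x r) ∧ x s = y}

attribute [instance] BanachScale.normed BanachScale.space BanachScale.complete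

namespace BanachScale

/-- Restriction of a scale along a strictly monotone map of index sets. -/
def reindex {ι κ : Type} [Preorder ι] [Preorder κ] (X : BanachScale.{u} ι) (f : κ → ι)
    (hf : StrictMono f) (hm : Monotone f) : BanachScale.{u} κ where
  layer s := X.layer (f s)
  bond h := X.bond (hm h)
  bond_self _ x := X.bond_self _ x
  bond_bond _ _ x := X.bond_bond _ _ x
  bond_injective h := X.bond_injective (hm h)
  bond_compact h := X.bond_compact (hf h)
  limit_dense s := by
    refine (X.limit_dense (f s)).mono ?_
    rintro y ⟨x, hx, rfl⟩
    exact ⟨fun t => x (f t), fun h => hx (hm h), rfl⟩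

/-- The restriction `X_{≥ 0}` of a scale on `ℤ` to `ℕ`. -/
def nonneg (X : BanachScale.{u} ℤ) : BanachScale.{u} ℕ :=
  X.reindex (fun m : ℕ => (m : ℤ)) (fun _ _ h => Int.ofNat_lt.2 h)
    (fun _ _ h => Int.ofNat_le.2 h)

/-- The shifted scale `X^1`, with layers `X_{m+1}`. -/
def shift (X : BanachScale.{u} ℕ) : BanachScale.{u} ℕ :=
  X.reindex (fun m => m + 1) (fun _ _ h => Nat.succ_lt_succ h) (fun _ _ h => Nat.succ_le_succ h)

/-- The product of two scales, layer by layer. -/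
def prod {ι : Type} [Preorder ι] (X : BanachScale.{u} ι) (Y : BanachScale.{v} ι) :
    BanachScale.{max u v} ι where
  layer s := X.layer s × Y.layer s
  bond h := (X.bond h).prodMap (Y.bond h)
  bond_self s x := Prod.ext (X.bond_self s x.1) (Y.bond_self s x.2)
  bond_bond hr hq x := Prod.ext (X.bond_bond hr hq x.1) (Y.bond_bond hr hq x.2)
  bond_injective h := (X.bond_injective h).prodMap (Y.bond_injective h)
  bond_compact h := by
    obtain ⟨K, hK, hK'⟩ := X.bond_compact h
    obtain ⟨L, hL, hL'⟩ := Y.bond_compact h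
    exact ⟨K ×ˢ L, hK.prod hL, prod_mem_nhds hK' hL'⟩
  limit_dense s := by
    refine ((X.limit_dense s).prod (Y.limit_dense s)).mono ?_
    rintro ⟨a, b⟩ ⟨⟨x, hx, rfl⟩, ⟨y, hy, rfl⟩⟩
    exact ⟨fun t => (x t, y t), fun h => Prod.ext (hx h) (hy h), rfl⟩

/-- For `x ∈ X_0`, the element of `X_m` that the bonding map sends to `x`; it is unique when it
exists, and it is only used when `x ∈ X_m`. -/
def lift (X : BanachScale.{u} ℕ) (m : ℕ) (x : X.layer 0) : X.layer m :=
  Function.invFun (X.bond (Nat.zero_le m)) x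

/-- The tangent scale `T X = X^1 × X`. -/
def tangent (X : BanachScale.{u} ℕ) : BanachScale.{u} ℕ := X.shift.prod X

end BanachScale

/-! ## Symplectic structures on scales -/

/-- A symplectic structure on a Banach scale on `ℤ`. The form `ω_s : X_s × X_{-s} → ℝ` is
`form (s := s) (t := t) h` for the only index `t` with `h : s + t = 0`. The induced maps
`ι_ω : X_s → (X_{-s})^*`, `w ↦ ω_{-s}(·, w)`, are compatible with the bonding maps of `X` and of the
dual scale, and bijective. -/
structure SymplecticForm (X : BanachScale.{u} ℤ) where
  form : ∀ {s t : ℤ}, s + t = 0 → X.layer s →L[ℝ] X.layer t →L[ℝ] ℝ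
  skew : ∀ {s t : ℤ} (h : s + t = 0) (h' : t + s = 0) (a : X.layer s) (b : X.layer t),
    form h a b = - form h' b a
  compat : ∀ {s t s' t' : ℤ} (h : t + s = 0) (h' : t' + s' = 0) (hs : s' ≤ s) (ht : t ≤ t')
    (a : X.layer t') (b : X.layer s), form h' a (X.bond hs b) = form h (X.bond ht a) b
  bijective : ∀ {s t : ℤ} (h : t + s = 0), Function.Bijective (form h).flip

namespace SymplecticForm

variable {X : BanachScale.{u} ℤ}

/-- The isomorphism `ι_ω : X_s ≃ (X_{-s})^*`, `w ↦ ω_{-s}(·, w)`, with `t = -s`. -/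
def iota (ω : SymplecticForm X) {s t : ℤ} (h : t + s = 0) : X.layer s ≃L[ℝ] (X.layer t →L[ℝ] ℝ) :=
  ContinuousLinearEquiv.ofBijective (ω.form h).flip
    (LinearMap.ker_eq_bot.2 (ω.bijective h).1) (LinearMap.range_eq_top.2 (ω.bijective h).2)

lemma iota_apply (ω : SymplecticForm X) {s t : ℤ} (h : t + s = 0) (b : X.layer s) (a : X.layer t) :
    ω.iota h b a = ω.form h a b := rfl

/-- The bonding map `(X_{-s})^* → (X_{-r})^*`, `r ≤ s`, of the dual scale: the adjoint of
`X_{-r} → X_{-s}`. -/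
def dualBond (X : BanachScale.{u} ℤ) {s r : ℤ} (h : r ≤ s) :
    (X.layer (-s) →L[ℝ] ℝ) →L[ℝ] (X.layer (-r) →L[ℝ] ℝ) :=
  (ContinuousLinearMap.compL ℝ (X.layer (-r)) (X.layer (-s)) ℝ).flip (X.bond (neg_le_neg h))

lemma dualBond_apply {s r : ℤ} (h : r ≤ s) (a : X.layer (-s) →L[ℝ] ℝ) (x : X.layer (-r)) :
    dualBond X h a x = a (X.bond (neg_le_neg h) x) := rfl

lemma dualBond_iota (ω : SymplecticForm X) {s r : ℤ} (h : r ≤ s) (x : X.layer s) :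
    dualBond X h (ω.iota (neg_add_cancel s) x) = ω.iota (neg_add_cancel r) (X.bond h x) := by
  ext a
  exact (ω.compat _ _ h (neg_le_neg h) a x).symm

lemma dualBond_injective (ω : SymplecticForm X) {s r : ℤ} (h : r ≤ s) : Function.Injective (dualBond X h) := by
  intro a b hab
  obtain ⟨x, rfl⟩ := (ω.iota (neg_add_cancel s)).surjective a
  obtain ⟨y, rfl⟩ := (ω.iota (neg_add_cancel s)).surjective b
  rw [ω.dualBond_iota, ω.dualBond_iota] at hab
  rw [X.bond_injective h ((ω.iota (neg_add_cancel r)).injective hab)]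

lemma dualBond_compact (ω : SymplecticForm X) {s r : ℤ} (h : r < s) : IsCompactOperator (dualBond X h.le) := by
  obtain ⟨K, hK, hK'⟩ := X.bond_compact h
  refine ⟨ω.iota (neg_add_cancel r) '' K, hK.image (ω.iota (neg_add_cancel r)).continuous, ?_⟩
  have h1 := (ω.iota (neg_add_cancel s)).symm.continuous.tendsto 0
  rw [map_zero] at h1
  filter_upwards [h1 hK'] with a ha
  refine ⟨_, ha, ?_⟩
  rw [← ω.dualBond_iota, ContinuousLinearEquiv.apply_symm_apply]

lemma dualBond_dense (ω : SymplecticForm X) (s : ℤ) : Dense {y : X.layer (-s) →L[ℝ] ℝ |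
    ∃ x : ∀ t, X.layer (-t) →L[ℝ] ℝ,
      (∀ {t r : ℤ} (h : r ≤ t), dualBond X h (x t) = x r) ∧ x s = y} := by
  have h1 := (ω.iota (neg_add_cancel s)).surjective.denseRange.dense_image
    (ω.iota (neg_add_cancel s)).continuous (X.limit_dense s)
  refine h1.mono ?_
  rintro _ ⟨_, ⟨x, hx, rfl⟩, rfl⟩
  exact ⟨fun t => ω.iota (neg_add_cancel t) (x t), fun h => by rw [ω.dualBond_iota, hx h], rfl⟩

/-- The dual scale `X^*` of a scale with a symplectic structure: its layer of index `s` is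
`(X_{-s})^*` with the operator norm, its bonding maps are the adjoints of those of `X`. The
symplectic structure only enters the proofs. -/
def dual (ω : SymplecticForm X) : BanachScale.{u} ℤ where
  layer s := X.layer (-s) →L[ℝ] ℝ
  normed _ := inferInstance
  space _ := inferInstance
  complete _ := inferInstance
  bond h := dualBond X h
  bond_self s a := ContinuousLinearMap.ext fun x => congrArg a (X.bond_self (-s) x)
  bond_bond hr hq a := ContinuousLinearMap.ext fun x =>
    congrArg a (X.bond_bond (neg_le_neg hq) (neg_le_neg hr) x)
  bond_injective h := ω.dualBond_injective h
  bond_compact h := ω.dualBond_compact h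
  limit_dense s := ω.dualBond_dense s

/-- The scale `X_{≥ 0}^1 × X^*` on `ℕ`, with layers `X_{m+1} × (X_{-m})^*`. -/
def cotangentModel (ω : SymplecticForm X) : BanachScale.{u} ℕ := X.nonneg.shift.prod ω.dual.nonneg

end SymplecticForm

/-! ## Scale calculus -/

section ScaleCalculus

/-- `f : U → Y`, `U ⊆ X_0`, is an `sc^0` map: `f` sends `U_m = U ∩ X_m` into `Y_m`, and the
restriction `U_m → Y_m` is continuous, for every `m`. -/
def IsScZero (X : BanachScale.{u} ℕ) (Y : BanachScale.{v} ℕ) (U : Set (X.layer 0))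
    (f : X.layer 0 → Y.layer 0) : Prop :=
  ∀ m : ℕ, ∃ g : X.layer m → Y.layer m,
    ContinuousOn g {x | X.bond (Nat.zero_le m) x ∈ U} ∧
    ∀ x, X.bond (Nat.zero_le m) x ∈ U → Y.bond (Nat.zero_le m) (g x) = f (X.bond (Nat.zero_le m) x)

/-- The tangent bundle `T U = U_1 × X_0` of `U ⊆ X_0`. -/
def tangentSet (X : BanachScale.{u} ℕ) (U : Set (X.layer 0)) : Set (X.tangent.layer 0) :=
  {q : X.layer 1 × X.layer 0 | X.bond (Nat.zero_le 1) q.1 ∈ U}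

/-- `D` is a scale derivative of `f : U → Y`: `(x, ξ) ↦ D x ξ` is an `sc^0` map `T U → Y` (linear in
the second argument), and for every `x ∈ U_1` the restriction of `f` to `U_1` with values in `Y_0`
is Fréchet differentiable at `x` with derivative the restriction of `D x` to `X_1`. The values of `D`
outside of `U_1` are irrelevant. -/
structure HasScDeriv (X : BanachScale.{u} ℕ) (Y : BanachScale.{v} ℕ) (U : Set (X.layer 0))
    (f : X.layer 0 → Y.layer 0) (D : X.layer 1 → X.layer 0 →L[ℝ] Y.layer 0) : Prop where
  scZero : IsScZero X.tangent Y (tangentSet X U)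
    (fun q : X.layer 1 × X.layer 0 => D q.1 q.2)
  frechet : ∀ x : X.layer 1, X.bond (Nat.zero_le 1) x ∈ U →
    HasFDerivAt (fun y : X.layer 1 => f (X.bond (Nat.zero_le 1) y))
      ((D x).comp (X.bond (Nat.zero_le 1))) x

/-- The scale derivative `D f` of `f : U → Y`; on `U_1` it is unique when it exists. -/
def scDeriv (X : BanachScale.{u} ℕ) (Y : BanachScale.{v} ℕ) (U : Set (X.layer 0))
    (f : X.layer 0 → Y.layer 0) : X.layer 1 → X.layer 0 →L[ℝ] Y.layer 0 :=
  open Classical in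
  if h : ∃ D, HasScDeriv X Y U f D then h.choose else fun _ => 0

/-- `f : U → Y`, `U ⊆ X_0` open, is `sc^k`: for `k + 1` this means that `f` is `sc^0`, has a scale
derivative, and its tangent map `T f : T U → T Y`, `(x, ξ) ↦ (f x, D f (x, ξ))` is `sc^k`; here `f₁`
is the restriction `U_1 → Y_1` of `f`. -/
def IsSc : ℕ → ∀ (X : BanachScale.{u} ℕ) (Y : BanachScale.{v} ℕ),
    Set (X.layer 0) → (X.layer 0 → Y.layer 0) → Prop
  | 0, X, Y, U, f => IsScZero X Y U f
  | k + 1, X, Y, U, f => IsScZero X Y U f ∧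
      ∃ (f₁ : X.layer 1 → Y.layer 1) (D : X.layer 1 → X.layer 0 →L[ℝ] Y.layer 0),
        (∀ x, X.bond (Nat.zero_le 1) x ∈ U →
          Y.bond (Nat.zero_le 1) (f₁ x) = f (X.bond (Nat.zero_le 1) x)) ∧
        HasScDeriv X Y U f D ∧
        IsSc k X.tangent Y.tangent (tangentSet X U)
          (fun q : X.layer 1 × X.layer 0 => ((f₁ q.1, D q.1 q.2) : Y.layer 1 × Y.layer 0))

/-- `f : U → Y` is sc-smooth, i.e. `sc^∞`. -/
def IsScSmooth (X : BanachScale.{u} ℕ) (Y : BanachScale.{v} ℕ) (U : Set (X.layer 0))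
    (f : X.layer 0 → Y.layer 0) : Prop :=
  ∀ k : ℕ, IsSc k X Y U f

end ScaleCalculus

/-! ## `sc^∞`-manifolds -/

/-- Two charts are `sc^∞`-compatible: the transition map, defined on `φ(U ∩ U')`, and its inverse are
sc-smooth. -/
def ScCompatible (X : BanachScale.{u} ℕ) {M : Type v} [TopologicalSpace M]
    (φ ψ : OpenPartialHomeomorph M (X.layer 0)) : Prop :=
  IsScSmooth X X (φ.symm.trans ψ).source (φ.symm.trans ψ) ∧
    IsScSmooth X X (ψ.symm.trans φ).source (ψ.symm.trans φ)

/-- An `sc^∞`-atlas for `M` modeled on `X`. -/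
structure IsScAtlas (X : BanachScale.{u} ℕ) (M : Type v) [TopologicalSpace M]
    (A : Set (OpenPartialHomeomorph M (X.layer 0))) : Prop where
  cover : ∀ p : M, ∃ φ ∈ A, p ∈ φ.source
  compatible : ∀ φ ∈ A, ∀ ψ ∈ A, ScCompatible X φ ψ

/-- An sc-smooth structure on a Hausdorff space `M`, i.e. a maximal `sc^∞`-atlas. -/
structure ScManifold (X : BanachScale.{u} ℕ) (M : Type v) [TopologicalSpace M] where
  t2 : T2Space M
  atlas : Set (OpenPartialHomeomorph M (X.layer 0))
  maximal : Maximal (IsScAtlas X M) atlas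

namespace ScManifold

variable {X : BanachScale.{u} ℕ} {M : Type v} [TopologicalSpace M] (𝓜 : ScManifold X M)

/-- The subset `M_m` of the filtration. -/
def level (m : ℕ) : Set M :=
  {p | ∃ φ ∈ 𝓜.atlas, p ∈ φ.source ∧ φ p ∈ range (X.bond (Nat.zero_le m))}

/-- The set `M_m` as a type, carrying the topology below instead of the subspace topology. -/
@[ext]
structure Level (m : ℕ) where
  pt : M
  mem : pt ∈ 𝓜.level m

/-- The topology of `M_m`: it has the sets `φ⁻¹(W)`, `W ⊆ X_m` open, as a basis, `φ` a chart. -/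
instance levelTopology (m : ℕ) : TopologicalSpace (𝓜.Level m) :=
  TopologicalSpace.generateFrom
    {s | ∃ φ ∈ 𝓜.atlas, ∃ W : Set (X.layer m), IsOpen W ∧
      s = {p : 𝓜.Level m | p.pt ∈ φ.source ∧ ∃ x ∈ W, X.bond (Nat.zero_le m) x = φ p.pt}}

/-- The charts of `M` around `p`. -/
def ChartAt (p : M) : Type (max u v) :=
  {φ : OpenPartialHomeomorph M (X.layer 0) // φ ∈ 𝓜.atlas ∧ p ∈ φ.source}

/-- The `m`-th layer `(T_p M)_m` of the tangent scale at `p ∈ M_{m+1}`: a tangent vector assigns to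
every chart `φ` around `p` a vector of `X_m`, its class being that of `(φ, v φ)`, such that
`v ψ = D(ψ ∘ φ⁻¹)(φ p)(v φ)` for all charts `φ`, `ψ` around `p`. Vector space operations and topology
are those for which reading off the vector in any given chart is an isomorphism. -/
def tangentSubmodule (p : M) (m : ℕ) : Submodule ℝ (𝓜.ChartAt p → X.layer m) where
  carrier := {v | ∀ φ ψ : 𝓜.ChartAt p, X.bond (Nat.zero_le m) (v ψ) =
    scDeriv X X (φ.1.symm.trans ψ.1).source (φ.1.symm.trans ψ.1) (X.lift 1 (φ.1 p))
      (X.bond (Nat.zero_le m) (v φ))}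
  add_mem' {a b} ha hb φ ψ := by
    simp only [Pi.add_apply, map_add, ← ha φ ψ, ← hb φ ψ]
  zero_mem' φ ψ := by simp
  smul_mem' c a ha φ ψ := by
    simp only [Pi.smul_apply, map_smul, ← ha φ ψ]

/-- The tangent space `(T_p M)_m`. -/
abbrev TangentSpace (p : M) (m : ℕ) : Type (max u v) := 𝓜.tangentSubmodule p m

/-- The map `(D_p φ)_m : (T_p M)_m → X_m` of a chart `φ` around `p`. -/
def chartDeriv {p : M} (φ : 𝓜.ChartAt p) (m : ℕ) : 𝓜.TangentSpace p m →L[ℝ] X.layer m :=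
  (ContinuousLinearMap.proj φ).comp (𝓜.tangentSubmodule p m).subtypeL

/-- The structure `𝓜₁` on `M_1` is the manifold `M^1` modeled on `X^1`: its charts include the
restrictions `φ_1 : U_1 → X_1` of the charts `φ : U → X_0` of `M`. -/
def IsShift (𝓜₁ : ScManifold X.shift (𝓜.Level 1)) : Prop :=
  ∀ φ ∈ 𝓜.atlas, ∃ φ₁ ∈ 𝓜₁.atlas, φ₁.source = {p : 𝓜.Level 1 | p.pt ∈ φ.source} ∧
    ∀ p ∈ φ₁.source, X.bond (Nat.zero_le 1) (φ₁ p) = φ p.pt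

section Maps

variable {Y : BanachScale.{u} ℕ} {N : Type w} [TopologicalSpace N] (𝓢 : ScManifold Y N)

/-- `f : M → N` is an `sc^0` map. -/
def IsScZeroMap (f : M → N) : Prop :=
  ∀ m : ℕ, ∃ g : 𝓜.Level m → 𝓢.Level m, Continuous g ∧ ∀ p, (g p).pt = f p.pt

/-- `f : M → N` is sc-smooth. -/
structure IsScSmoothMap (f : M → N) : Prop where
  scZero : 𝓜.IsScZeroMap 𝓢 f
  smooth : ∀ p : M, ∃ φ ∈ 𝓜.atlas, ∃ ψ ∈ 𝓢.atlas, p ∈ φ.source ∧ f p ∈ ψ.source ∧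
    MapsTo f φ.source ψ.source ∧ IsScSmooth X Y φ.target (ψ ∘ f ∘ φ.symm)

/-- `L` is the `m`-th layer `(D_p f)_m : (T_p M)_m → (T_{f p} N)_m` of the derivative of `f`:
`(D_{f p} ψ)(L v) = D(ψ ∘ f ∘ φ⁻¹)(φ p)((D_p φ) v)` for all charts `φ` around `p` and `ψ` around
`f p` such that `f` maps the domain of `φ` into that of `ψ`. -/
def HasDerivMap (f : M → N) (p : M) (m : ℕ)
    (L : 𝓜.TangentSpace p m →L[ℝ] 𝓢.TangentSpace (f p) m) : Prop :=
  ∀ (φ : 𝓜.ChartAt p) (ψ : 𝓢.ChartAt (f p)), MapsTo f φ.1.source ψ.1.source →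
    ∀ v, Y.bond (Nat.zero_le m) (𝓢.chartDeriv ψ m (L v)) =
      scDeriv X Y φ.1.target (ψ.1 ∘ f ∘ φ.1.symm) (X.lift 1 (φ.1 p))
        (X.bond (Nat.zero_le m) (𝓜.chartDeriv φ m v))

/-- `f` is an sc-smooth submersion: it is sc-smooth, and for all `p ∈ M_{m+1}` every layer
`(D_p f)_k`, `k ≤ m`, of `D_p f` is surjective. -/
structure IsScSubmersion (f : M → N) : Prop where
  smooth : 𝓜.IsScSmoothMap 𝓢 f
  surjective : ∀ (m : ℕ), ∀ p ∈ 𝓜.level (m + 1), ∀ k ≤ m,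
    ∃ L : 𝓜.TangentSpace p k →L[ℝ] 𝓢.TangentSpace (f p) k,
      𝓜.HasDerivMap 𝓢 f p k L ∧ Function.Surjective L

end Maps

end ScManifold

/-! ## Symplectic `sc^∞`-manifolds -/

/-- Two charts are symplectically compatible: the transition map `f` is an sc-smooth diffeomorphism
with `ω(D_x f v, D_x f w) = ω(v, w)` for all `x ∈ φ(U ∩ U')_1` and `v, w ∈ X_0`. -/
structure SymplecticCompatible {X : BanachScale.{u} ℤ} (ω : SymplecticForm X) {M : Type v}
    [TopologicalSpace M] (φ ψ : OpenPartialHomeomorph M (X.nonneg.layer 0)) : Prop where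
  compatible : ScCompatible X.nonneg φ ψ
  symplectic : ∀ x : X.nonneg.layer 1,
    X.nonneg.bond (Nat.zero_le 1) x ∈ (φ.symm.trans ψ).source → ∀ a b : X.nonneg.layer 0,
    ω.form (s := ((0 : ℕ) : ℤ)) (t := ((0 : ℕ) : ℤ)) (by simp)
      (scDeriv X.nonneg X.nonneg (φ.symm.trans ψ).source (φ.symm.trans ψ) x a)
      (scDeriv X.nonneg X.nonneg (φ.symm.trans ψ).source (φ.symm.trans ψ) x b) =
    ω.form (s := ((0 : ℕ) : ℤ)) (t := ((0 : ℕ) : ℤ)) (by simp) a b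

/-- A symplectic atlas for the `sc^∞`-manifold `𝓜`. -/
structure IsSymplecticAtlas {X : BanachScale.{u} ℤ} (ω : SymplecticForm X) {M : Type v}
    [TopologicalSpace M] (𝓜 : ScManifold X.nonneg M)
    (A : Set (OpenPartialHomeomorph M (X.nonneg.layer 0))) : Prop where
  subset : A ⊆ 𝓜.atlas
  cover : ∀ p : M, ∃ φ ∈ A, p ∈ φ.source
  compatible : ∀ φ ∈ A, ∀ ψ ∈ A, SymplecticCompatible ω φ ψ

/-- A symplectic `sc^∞`-manifold modeled on `(X, ω)`. -/
structure SymplecticScManifold {X : BanachScale.{u} ℤ} (ω : SymplecticForm X) (M : Type v)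
    [TopologicalSpace M] extends ScManifold X.nonneg M where
  symplecticAtlas : Set (OpenPartialHomeomorph M (X.nonneg.layer 0))
  isMaximal : Maximal (IsSymplecticAtlas ω toScManifold) symplecticAtlas

/-! ## Banachable scales -/

/-- A family of topological vector spaces and maps between them, indexed by `ι`. -/
structure TVSSystem (ι : Type) [Preorder ι] where
  layer : ι → Type u
  [group : ∀ s, AddCommGroup (layer s)]
  [module : ∀ s, Module ℝ (layer s)]
  [topology : ∀ s, TopologicalSpace (layer s)]
  [topGroup : ∀ s, IsTopologicalAddGroup (layer s)]
  [smul : ∀ s, ContinuousSMul ℝ (layer s)]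
  bond : ∀ {s r : ι}, r ≤ s → layer s →L[ℝ] layer r

attribute [instance] TVSSystem.group TVSSystem.module TVSSystem.topology TVSSystem.topGroup
  TVSSystem.smul

/-- The family is a Banachable scale: it satisfies the axioms of a Banach scale, except that the
layers are only completely normable. -/
structure TVSSystem.IsBanachableScale {ι : Type} [Preorder ι] (X : TVSSystem.{u} ι) : Prop where
  banachable : ∀ s, ∃ (E : Type u) (_ : NormedAddCommGroup E) (_ : NormedSpace ℝ E),
    CompleteSpace E ∧ Nonempty (X.layer s ≃L[ℝ] E)
  bond_self : ∀ (s : ι) (x : X.layer s), X.bond (le_refl s) x = x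
  bond_bond : ∀ {s r q : ι} (hr : r ≤ s) (hq : q ≤ r) (x : X.layer s),
    X.bond hq (X.bond hr x) = X.bond (hq.trans hr) x
  bond_injective : ∀ {s r : ι} (h : r ≤ s), Function.Injective (X.bond h)
  bond_compact : ∀ {s r : ι} (h : r < s), IsCompactOperator (X.bond h.le)
  limit_dense : ∀ s : ι, Dense {y : X.layer s | ∃ x : ∀ t, X.layer t,
    (∀ {t r : ι} (h : r ≤ t), X.bond h (x t) = x r) ∧ x s = y}

/-- Restriction to a subset of the index set. -/
def TVSSystem.restrict {ι : Type} [Preorder ι] (X : TVSSystem.{u} ι) (S : Set ι) :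
    TVSSystem.{u} S where
  layer s := X.layer s
  bond h := X.bond h

/-- The dual family: the layer of index `s` is `(X_{-s})^*`, with the topology of uniform convergence
on bounded sets (the norm topology for Banachable spaces), and the bonding maps are the adjoints. -/
def TVSSystem.dual (X : TVSSystem.{u} ℤ) : TVSSystem.{u} ℤ where
  layer s := X.layer (-s) →L[ℝ] ℝ
  bond h := ContinuousLinearMap.precomp ℝ (X.bond (neg_le_neg h))

namespace SymplecticScManifold

variable {X : BanachScale.{u} ℤ} {ω : SymplecticForm X} {M : Type v} [TopologicalSpace M]
  (𝓜 : SymplecticScManifold ω M)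

/-- The charts around `p` that belong to the symplectic atlas. -/
def SymplecticChartAt (p : M) : Type (max u v) :=
  {φ : 𝓜.ChartAt p // φ.1 ∈ 𝓜.symplecticAtlas}

/-- The layers of the extended tangent scale at `p`: `(T_p M)_s` for `s ≥ 0`, and the dual of
`(T_p M)_{-s}` for `s < 0`. -/
def ExtLayer (p : M) : ℤ → Type (max u v)
  | Int.ofNat k => 𝓜.TangentSpace p k
  | Int.negSucc k => 𝓜.TangentSpace p (k + 1) →L[ℝ] ℝ

instance (p : M) : ∀ s, AddCommGroup (𝓜.ExtLayer p s)
  | Int.ofNat k => inferInstanceAs (AddCommGroup (𝓜.TangentSpace p k))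
  | Int.negSucc k => inferInstanceAs (AddCommGroup (𝓜.TangentSpace p (k + 1) →L[ℝ] ℝ))

instance (p : M) : ∀ s, Module ℝ (𝓜.ExtLayer p s)
  | Int.ofNat k => inferInstanceAs (Module ℝ (𝓜.TangentSpace p k))
  | Int.negSucc k => inferInstanceAs (Module ℝ (𝓜.TangentSpace p (k + 1) →L[ℝ] ℝ))

instance (p : M) : ∀ s, TopologicalSpace (𝓜.ExtLayer p s)
  | Int.ofNat k => inferInstanceAs (TopologicalSpace (𝓜.TangentSpace p k))
  | Int.negSucc k => inferInstanceAs (TopologicalSpace (𝓜.TangentSpace p (k + 1) →L[ℝ] ℝ))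

instance (p : M) : ∀ s, IsTopologicalAddGroup (𝓜.ExtLayer p s)
  | Int.ofNat k => inferInstanceAs (IsTopologicalAddGroup (𝓜.TangentSpace p k))
  | Int.negSucc k => inferInstanceAs (IsTopologicalAddGroup (𝓜.TangentSpace p (k + 1) →L[ℝ] ℝ))

instance (p : M) : ∀ s, ContinuousSMul ℝ (𝓜.ExtLayer p s)
  | Int.ofNat k => inferInstanceAs (ContinuousSMul ℝ (𝓜.TangentSpace p k))
  | Int.negSucc k => inferInstanceAs (ContinuousSMul ℝ (𝓜.TangentSpace p (k + 1) →L[ℝ] ℝ))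

/-- The extension of `D_p φ` to negative indices: for `s ≥ 0` it is `(D_p φ)_s`, and for `s < 0` it is
`((D_p φ)_{-s}⁻¹)^* : (T_p M)_{-s}^* → X_{-s}^*` followed by the inverse of `ι_ω : X_s → X_{-s}^*`. -/
def extDeriv {p : M} (φ : 𝓜.SymplecticChartAt p) : ∀ s : ℤ, 𝓜.ExtLayer p s →L[ℝ] X.layer s
  | Int.ofNat k => 𝓜.chartDeriv φ.1 k
  | Int.negSucc k =>
      ((ω.iota (s := Int.negSucc k) (t := ((k + 1 : ℕ) : ℤ))
          (by rw [Int.negSucc_eq]; push_cast; ring)).symm :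
        (X.layer ((k + 1 : ℕ) : ℤ) →L[ℝ] ℝ) →L[ℝ] X.layer (Int.negSucc k)).comp
      (ContinuousLinearMap.precomp ℝ (𝓜.chartDeriv φ.1 (k + 1)).inverse)

/-- The extended tangent scale at `p`, whose bonding maps are those of `X` pulled back by the extended
`D_p φ`, for a symplectic chart `φ` around `p`. For `p ∈ M_{m+1}` it is meaningful for the indices `s`
with `-m ≤ s ≤ m`. -/
def extTangent {p : M} (φ : 𝓜.SymplecticChartAt p) : TVSSystem.{max u v} ℤ where
  layer := 𝓜.ExtLayer p
  bond {s r} h := (𝓜.extDeriv φ r).inverse.comp ((X.bond h).comp (𝓜.extDeriv φ s))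

/-! ## The cotangent bundle -/

/-- The cotangent bundle `T^*M`, as a set: pairs of a point `p ∈ M_1` and an element of
`(T_p M)_0^*`. -/
@[ext]
structure Cotangent where
  base : 𝓜.Level 1
  covector : 𝓜.TangentSpace base.pt 0 →L[ℝ] ℝ

/-- The map `(T_p M)_{-m}^* → (T_p M)_0^*` adjoint to the bonding map `(T_p M)_0 → (T_p M)_{-m}` of
the extended tangent scale. -/
def toCovector {p : M} (φ : 𝓜.SymplecticChartAt p) (m : ℕ)
    (β : (𝓜.extTangent φ).dual.layer (m : ℤ)) : 𝓜.TangentSpace p 0 →L[ℝ] ℝ :=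
  ContinuousLinearMap.comp (M₂ := (𝓜.extTangent φ).layer (-(m : ℤ))) β
    ((𝓜.extTangent φ).bond (s := (0 : ℤ)) (r := -(m : ℤ)) (by simp))

/-- `Φ` is the chart `T^*φ : T^*U → φ(U)_1 × X_0^*`, `(p, α) ↦ (φ p, ((D_p φ)_0⁻¹)^* α)`, induced by
the chart `φ` of `M`. -/
structure IsCotangentChart [TopologicalSpace 𝓜.Cotangent]
    (φ : OpenPartialHomeomorph M (X.nonneg.layer 0)) (hφ : φ ∈ 𝓜.atlas)
    (Φ : OpenPartialHomeomorph 𝓜.Cotangent (ω.cotangentModel.layer 0)) : Prop where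
  source : Φ.source = {q | q.base.pt ∈ φ.source}
  target : Φ.target = {z : X.nonneg.layer 1 × (X.layer 0 →L[ℝ] ℝ) |
    X.nonneg.bond (Nat.zero_le 1) z.1 ∈ φ.target}
  fst : ∀ q ∈ Φ.source, X.nonneg.bond (Nat.zero_le 1)
    (show X.nonneg.layer 1 × (X.layer 0 →L[ℝ] ℝ) from Φ q).1 = φ q.base.pt
  snd : ∀ (q : 𝓜.Cotangent) (h : q.base.pt ∈ φ.source),
    (show X.nonneg.layer 1 × (X.layer 0 →L[ℝ] ℝ) from Φ q).2 =
      q.covector.comp (𝓜.chartDeriv ⟨φ, hφ, h⟩ 0).inverse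

end SymplecticScManifold

end

/-! The obstacle is that a coordinate change of the cotangent bundle acts on covectors by the
adjoint of the inverse of `D f x`, where `f` is a transition map. Scale calculus makes `(x, ξ) ↦ D f
x ξ` jointly continuous but not continuous in operator norm, so nothing can be said directly about
inverses and adjoints. The symplectic condition removes the problem: if `D f x` preserves `ω_0`,
then `ι_ω` intertwines `D f x` with the adjoint of its inverse. Hence the isomorphism of scales `id
× ι_ω` from `X^1 × X` to `X^1 × X^*` conjugates the tangent map of `f` to the coordinate change of
the cotangent bundle (`cotangentMap_transition`). The tangent map of an sc-smooth map is sc-smooth,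
and so the maps `T^*φ` of symplectic charts form an atlas (`isScSmooth_cotangentTransition`,
`exists_scManifold_cotangent`).

The remaining claims are read off in these charts. The bonding maps of the extended tangent scale
are pulled back from `X`, so dualising `D_p φ` identifies the dual tangent scale with `X^*` on the
available indices (`extDualEquiv_bond`). Under this identification a covector comes from index `-m`
exactly when its representative lies in layer `m` of `X^*` (`cotangentMap_toCovector`), which gives
the filtration. The projection becomes the linear projection to the first factor
(`isScSubmersion_base`), and a fibre becomes a slice with fixed first component
(`exists_isEmbedding_fibre`).

Tangent spaces and compositions rest on the chain rule of scale calculus, `IsSc.comp`. It needs an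
analytic argument, since the inner map is differentiable only with values in the weaker layer;
compactness of the bonding maps compensates for the missing norm continuity of the outer derivative.
-/

/-! ### The analytic core of the chain rule -/

/-- Chain rule for maps that are differentiable only after weakening the norm of the target; the
derivative of the inner map is compact and that of the outer map is jointly continuous. -/
theorem hasFDerivAt_comp_of_isCompactOperator {E F₁ F₀ G : Type*}
    [NormedAddCommGroup E] [NormedSpace ℝ E] [NormedAddCommGroup F₁] [NormedSpace ℝ F₁]
    [NormedAddCommGroup F₀] [NormedSpace ℝ F₀] [NormedAddCommGroup G] [NormedSpace ℝ G]
    {j : F₁ →L[ℝ] F₀} {f : E → F₁} {x : E} {A : E →L[ℝ] F₀} {g : F₁ → G}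
    {B : F₁ → F₀ →L[ℝ] G} (hA : IsCompactOperator A) (hf : ContinuousAt f x)
    (hf' : HasFDerivAt (fun y => j (f y)) A x)
    (hg : ∀ᶠ y in 𝓝 (f x), HasFDerivAt g ((B y).comp j) y)
    (hB : ∀ η, ContinuousAt (fun q : F₁ × F₀ => B q.1 q.2) (f x, η)) :
    HasFDerivAt (fun y => g (f y)) ((B (f x)).comp A) x := by
  -- Joint continuity at `(f x, 0)` bounds `B y` on a fixed ball for all `y` near `f x`; scaling
  -- turns this into a uniform operator bound.
  obtain ⟨C, hC0, hC⟩ : ∃ C > 0, ∀ᶠ y in 𝓝 (f x), ∀ η, ‖B y η‖ ≤ C * ‖η‖ := by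
    have h1 : ∀ᶠ q : F₁ × F₀ in 𝓝 (f x, 0), ‖B q.1 q.2‖ < 1 := by
      have := (hB 0).norm
      refine this.eventually_lt continuousAt_const ?_
      simp
    rw [nhds_prod_eq] at h1
    obtain ⟨P, hP, Q, hQ, hPQ⟩ := Filter.eventually_prod_iff.1 h1
    obtain ⟨δ, hδ, hδQ⟩ := Metric.eventually_nhds_iff.1 hQ
    refine ⟨2 / δ, by positivity, hP.mono fun y hy η => ?_⟩
    rcases eq_or_ne η 0 with rfl | hη
    · simp
    have hn : 0 < ‖η‖ := norm_pos_iff.2 hη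
    have h2 : ‖B y ((δ / (2 * ‖η‖)) • η)‖ < 1 := by
      refine hPQ hy (hδQ ?_)
      rw [dist_zero_right, norm_smul, Real.norm_of_nonneg (by positivity)]
      field_simp
      linarith
    rw [map_smul, norm_smul, Real.norm_of_nonneg (by positivity)] at h2
    rw [div_mul_eq_mul_div, div_lt_one (by positivity)] at h2
    rw [div_mul_eq_mul_div, le_div_iff₀ hδ]
    linarith
  obtain ⟨K, hK, hAK⟩ := hA.image_closedBall_subset_compact 1
  rw [hasFDerivAt_iff_isLittleO_nhds_zero, Asymptotics.isLittleO_iff]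
  intro ε hε
  -- `B` is only strongly continuous; on the compact set `K`, which contains the image under `A` of
  -- the unit ball, this becomes uniform.
  have hcomp : ∀ᶠ y in 𝓝 (f x), ∀ η ∈ K, ‖B y η - B (f x) η‖ < ε / 2 := by
    refine hK.eventually_forall_of_forall_eventually fun η _ => ?_
    have h1 : ContinuousAt (fun q : F₁ × F₀ => ‖B q.1 q.2 - B (f x) q.2‖) (f x, η) :=
      ((hB η).sub ((B (f x)).continuous.continuousAt.comp continuousAt_snd)).norm
    refine h1.eventually_lt continuousAt_const ?_
    simpa using half_pos hε
  obtain ⟨r, hr, hball⟩ := Metric.eventually_nhds_iff_ball.1 (hg.and (hC.and hcomp))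
  have hf0 : Tendsto (fun h => f (x + h)) (𝓝 0) (𝓝 (f x)) := by
    have : Tendsto (fun h => x + h) (𝓝 0) (𝓝 x) := by
      exact (continuous_const_add x).tendsto' 0 x (add_zero x)
    exact hf.tendsto.comp this
  rw [hasFDerivAt_iff_isLittleO_nhds_zero, Asymptotics.isLittleO_iff] at hf'
  -- The tolerance is chosen so that the local bound `C` turns the differentiability error of `j ∘
  -- f` into `ε / 2 * ‖h‖`.
  filter_upwards [hf0 (Metric.ball_mem_nhds _ hr), hf' (show 0 < ε / (2 * C) by positivity)]
    with h hh hd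
  set k := f (x + h) - f x with hk
  have hseg : ∀ t ∈ Icc (0 : ℝ) 1, f x + t • k ∈ Metric.ball (f x) r := by
    intro t ht
    have := (convex_ball (f x) r).add_smul_sub_mem (Metric.mem_ball_self hr) hh ht
    exact this
  have hAh : ∀ y ∈ Metric.ball (f x) r, ‖B y (A h) - B (f x) (A h)‖ ≤ ε / 2 * ‖h‖ := by
    intro y hy
    rcases eq_or_ne h 0 with rfl | hh0
    · simp
    have hn : 0 < ‖h‖ := norm_pos_iff.2 hh0
    have h1 := (hball y hy).2.2 (A (‖h‖⁻¹ • h)) (hAK ⟨_, by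
      rw [mem_closedBall_zero_iff, norm_smul, norm_inv, norm_norm, inv_mul_cancel₀ hn.ne'], rfl⟩)
    rw [map_smul, map_smul, map_smul, ← smul_sub, norm_smul, norm_inv, norm_norm,
      inv_mul_lt_iff₀ hn] at h1
    linarith
  -- The segment from `f x` to `f (x + h)` lies in `F₁`, where `g` is differentiable. The mean value
  -- inequality is applied to `g` along it, minus the expected linear term.
  have hder : ∀ t ∈ Icc (0 : ℝ) 1, HasDerivWithinAt
      (fun t : ℝ => g (f x + t • k) - t • B (f x) (A h))
      (B (f x + t • k) (j k) - B (f x) (A h)) (Icc 0 1) t := by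
    intro t ht
    have h1 : HasDerivAt (fun t : ℝ => f x + t • k) k t := by
      simpa using ((hasDerivAt_id t).smul_const k).const_add (f x)
    have h2 := (hball _ (hseg t ht)).1.comp_hasDerivAt t h1
    have h3 : HasDerivAt (fun t : ℝ => t • B (f x) (A h)) (B (f x) (A h)) t := by
      simpa using (hasDerivAt_id t).smul_const (B (f x) (A h))
    exact (h2.sub h3).hasDerivWithinAt
  have hbound : ∀ t ∈ Ico (0 : ℝ) 1, ‖B (f x + t • k) (j k) - B (f x) (A h)‖ ≤ ε * ‖h‖ := by
    intro t ht
    have hy := hseg t ⟨ht.1, ht.2.le⟩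
    have h1 := (hball _ hy).2.1 (j k - A h)
    have h2 := hAh _ hy
    have h3 : ‖j k - A h‖ ≤ ε / (2 * C) * ‖h‖ := by
      simpa [hk] using hd
    -- The velocity splits into `j k - A h`, controlled by the bound `C`, and `A h`, controlled by
    -- compactness.
    calc ‖B (f x + t • k) (j k) - B (f x) (A h)‖
        = ‖B (f x + t • k) (j k - A h) + (B (f x + t • k) (A h) - B (f x) (A h))‖ := by
          rw [map_sub (B (f x + t • k)) (j k) (A h), sub_add_sub_cancel]
      _ ≤ C * (ε / (2 * C) * ‖h‖) + ε / 2 * ‖h‖ :=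
          (norm_add_le _ _).trans (add_le_add (h1.trans (by gcongr)) h2)
      _ = ε * ‖h‖ := by field_simp; ring
  have := norm_image_sub_le_of_norm_deriv_le_segment_01' hder hbound
  simpa [hk, sub_right_comm] using this

/-! ### Elementary facts about scales -/

noncomputable section

namespace BanachScale

variable {ι : Type} [Preorder ι]

lemma lift_bond (X : BanachScale.{u} ℕ) (m : ℕ) (y : X.layer m) :
    X.lift m (X.bond (Nat.zero_le m) y) = y :=
  Function.leftInverse_invFun (X.bond_injective _) y

lemma bond_lift (X : BanachScale.{u} ℕ) {m : ℕ} {x : X.layer 0}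
    (hx : x ∈ range (X.bond (Nat.zero_le m))) : X.bond (Nat.zero_le m) (X.lift m x) = x :=
  Function.invFun_eq hx

lemma lift_zero (X : BanachScale.{u} ℕ) (x : X.layer 0) : X.lift 0 x = x := by
  conv_lhs => rw [← X.bond_self 0 x]
  exact X.lift_bond 0 x

lemma denseRange_bond (X : BanachScale.{u} ι) {s r : ι} (h : r ≤ s) : DenseRange (X.bond h) := by
  refine (X.limit_dense r).mono ?_
  rintro y ⟨x, hx, hy⟩
  exact ⟨x s, (hx h).trans hy⟩

lemma range_bond_subset (X : BanachScale.{u} ι) {s r q : ι} (hr : r ≤ s) (hq : q ≤ r) :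
    range (X.bond (hq.trans hr)) ⊆ range (X.bond hq) := by
  rintro _ ⟨x, rfl⟩
  exact ⟨X.bond hr x, X.bond_bond hr hq x⟩

lemma isOpen_preimage_bond (X : BanachScale.{u} ℕ) {U : Set (X.layer 0)} (hU : IsOpen U) (m : ℕ) :
    IsOpen {x : X.layer m | X.bond (Nat.zero_le m) x ∈ U} :=
  hU.preimage (X.bond _).continuous

end BanachScale

/-! ### Maps of class sc^0 -/

section ScZero

variable {X : BanachScale.{u} ℕ} {Y : BanachScale.{v} ℕ} {Z : BanachScale.{w} ℕ}
  {U V : Set (X.layer 0)} {W : Set (Y.layer 0)} {f f' : X.layer 0 → Y.layer 0}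
  {g : Y.layer 0 → Z.layer 0}

/-- Injectivity of the bonding maps forces the restriction to layer `m` to be the lift. With this
canonical choice the condition can be checked locally. -/
lemma isScZero_iff : IsScZero X Y U f ↔ ∀ m : ℕ,
    (∀ x, X.bond (Nat.zero_le m) x ∈ U → f (X.bond (Nat.zero_le m) x) ∈ range (Y.bond (Nat.zero_le m))) ∧
    ContinuousOn (fun x => Y.lift m (f (X.bond (Nat.zero_le m) x)))
      {x | X.bond (Nat.zero_le m) x ∈ U} := by
  refine forall_congr' fun m => ⟨?_, ?_⟩
  · rintro ⟨g, hg, hgf⟩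
    refine ⟨fun x hx => ⟨g x, hgf x hx⟩, hg.congr fun x hx => ?_⟩
    rw [← hgf x hx, Y.lift_bond]
  · rintro ⟨h1, h2⟩
    exact ⟨_, h2, fun x hx => Y.bond_lift (h1 x hx)⟩

lemma IsScZero.mem_range (hf : IsScZero X Y U f) {m : ℕ} {x : X.layer 0} (hx : x ∈ U)
    (hm : x ∈ range (X.bond (Nat.zero_le m))) : f x ∈ range (Y.bond (Nat.zero_le m)) := by
  obtain ⟨y, rfl⟩ := hm
  exact (isScZero_iff.1 hf m).1 y hx

lemma IsScZero.continuousOn_lift (hf : IsScZero X Y U f) (m : ℕ) :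
    ContinuousOn (fun x => Y.lift m (f (X.bond (Nat.zero_le m) x)))
      {x | X.bond (Nat.zero_le m) x ∈ U} := (isScZero_iff.1 hf m).2

lemma IsScZero.continuousOn (hf : IsScZero X Y U f) : ContinuousOn f U := by
  have h := hf.continuousOn_lift 0
  simp only [X.bond_self, Y.lift_zero] at h
  exact h

lemma IsScZero.mono (hf : IsScZero X Y U f) (h : V ⊆ U) : IsScZero X Y V f := fun m => by
  obtain ⟨g, hg, hgf⟩ := hf m
  exact ⟨g, hg.mono fun x hx => h hx, fun x hx => hgf x (h hx)⟩

lemma IsScZero.congr (hf : IsScZero X Y U f) (h : EqOn f f' U) : IsScZero X Y U f' := fun m => by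
  obtain ⟨g, hg, hgf⟩ := hf m
  exact ⟨g, hg, fun x hx => (hgf x hx).trans (h hx)⟩

lemma IsScZero.comp (hg : IsScZero Y Z W g) (hf : IsScZero X Y U f) (h : MapsTo f U W) :
    IsScZero X Z U (g ∘ f) := fun m => by
  obtain ⟨f₁, hf₁, hff⟩ := hf m
  obtain ⟨g₁, hg₁, hgg⟩ := hg m
  have hm : MapsTo f₁ {x | X.bond (Nat.zero_le m) x ∈ U} {y | Y.bond (Nat.zero_le m) y ∈ W} :=
    fun x hx => by
      change Y.bond (Nat.zero_le m) (f₁ x) ∈ W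
      rw [hff x hx]; exact h hx
  exact ⟨g₁ ∘ f₁, hg₁.comp hf₁ hm, fun x hx => by
    rw [Function.comp_apply, hgg _ (hm hx), hff x hx, Function.comp_apply]⟩

lemma IsScZero.of_local
    (h : ∀ x ∈ U, ∃ V, IsOpen V ∧ x ∈ V ∧ IsScZero X Y V f) : IsScZero X Y U f := by
  rw [isScZero_iff]
  refine fun m => ⟨fun x hx => ?_, fun x hx => ?_⟩
  · obtain ⟨V, -, hxV, hV⟩ := h _ hx
    exact hV.mem_range hxV ⟨x, rfl⟩
  · obtain ⟨V, hVo, hxV, hV⟩ := h _ hx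
    exact ((hV.continuousOn_lift m).continuousAt
      ((X.isOpen_preimage_bond hVo m).mem_nhds hxV)).continuousWithinAt

end ScZero

/-! ### Scale derivatives -/

section ScDeriv

variable {X : BanachScale.{u} ℕ} {Y : BanachScale.{v} ℕ} {Z : BanachScale.{w} ℕ}
  {U V : Set (X.layer 0)} {W : Set (Y.layer 0)} {f f' : X.layer 0 → Y.layer 0}
  {g : Y.layer 0 → Z.layer 0} {D D' : X.layer 1 → X.layer 0 →L[ℝ] Y.layer 0}
  {B : Y.layer 1 → Y.layer 0 →L[ℝ] Z.layer 0}

lemma isOpen_tangentSet (hU : IsOpen U) : IsOpen (tangentSet X U) :=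
  (X.isOpen_preimage_bond hU 1).preimage (continuous_fst (X := X.layer 1) (Y := X.layer 0))

/-- The Fréchet derivative determines `D x` on the image of `X_1`, which is dense in `X_0`. -/
lemma HasScDeriv.unique (h : HasScDeriv X Y U f D) (h' : HasScDeriv X Y V f D') {x : X.layer 1}
    (hx : X.bond (Nat.zero_le 1) x ∈ U) (hx' : X.bond (Nat.zero_le 1) x ∈ V) : D x = D' x := by
  have h1 := (h.frechet x hx).unique (h'.frechet x hx')
  ext v
  refine congrFun ((X.denseRange_bond (Nat.zero_le 1)).equalizer (D x).continuous
    (D' x).continuous (funext fun y => ?_)) v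
  exact congrArg (fun L : X.layer 1 →L[ℝ] Y.layer 0 => L y) h1

lemma HasScDeriv.mono (h : HasScDeriv X Y U f D) (hV : V ⊆ U) : HasScDeriv X Y V f D where
  scZero := h.scZero.mono fun _ hx => hV hx
  frechet x hx := h.frechet x (hV hx)

lemma HasScDeriv.congr (h : HasScDeriv X Y U f D) (hU : IsOpen U) (hf : EqOn f f' U) :
    HasScDeriv X Y U f' D where
  scZero := h.scZero
  frechet x hx := (h.frechet x hx).congr_of_eventuallyEq <| by
    filter_upwards [(X.isOpen_preimage_bond hU 1).mem_nhds hx] with y hy using (hf hy).symm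

lemma HasScDeriv.congr_deriv (h : HasScDeriv X Y U f D)
    (hD : ∀ x, X.bond (Nat.zero_le 1) x ∈ U → D x = D' x) : HasScDeriv X Y U f D' where
  scZero := h.scZero.congr fun q hq => congrArg (fun L => L (show X.layer 1 × X.layer 0 from q).2) (hD _ hq)
  frechet x hx := hD x hx ▸ h.frechet x hx

lemma HasScDeriv.hasScDeriv_scDeriv (h : HasScDeriv X Y U f D) :
    HasScDeriv X Y U f (scDeriv X Y U f) := by
  have h' : ∃ D, HasScDeriv X Y U f D := ⟨D, h⟩
  rw [scDeriv, dif_pos h']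
  exact h'.choose_spec

lemma HasScDeriv.scDeriv_eq (h : HasScDeriv X Y U f D) {x : X.layer 1}
    (hx : X.bond (Nat.zero_le 1) x ∈ U) : scDeriv X Y U f x = D x :=
  h.hasScDeriv_scDeriv.unique h hx hx

/-- Local derivatives agree on overlaps by uniqueness, so choosing one at each point glues them. -/
lemma HasScDeriv.of_local (hU : IsOpen U)
    (h : ∀ x ∈ U, ∃ V, IsOpen V ∧ x ∈ V ∧ ∃ D, HasScDeriv X Y V f D) :
    ∃ D, HasScDeriv X Y U f D := by
  choose! V hVo hxV D hD using h
  have key : ∀ x ∈ U, ∀ y : X.layer 1, X.bond (Nat.zero_le 1) y ∈ U →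
      X.bond (Nat.zero_le 1) y ∈ V x → D (X.bond (Nat.zero_le 1) y) y = D x y :=
    fun x hx y hy hyV => (hD _ hy).unique (hD x hx) (hxV _ hy) hyV
  have hloc : ∀ x ∈ U, HasScDeriv X Y (U ∩ V x) f fun y => D (X.bond (Nat.zero_le 1) y) y :=
    fun x hx => ((hD x hx).mono inter_subset_right).congr_deriv
      fun y hy => (key x hx y hy.1 hy.2).symm
  refine ⟨fun y => D (X.bond (Nat.zero_le 1) y) y, IsScZero.of_local fun q hq => ?_, fun x hx => ?_⟩
  · exact ⟨tangentSet X (U ∩ V _), isOpen_tangentSet (hU.inter (hVo _ hq)), ⟨hq, hxV _ hq⟩,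
      (hloc _ hq).scZero⟩
  · exact (hloc _ hx).frechet x ⟨hx, hxV _ hx⟩

lemma HasScDeriv.continuousOn (h : HasScDeriv X Y U f D) :
    ContinuousOn (fun q : X.layer 1 × X.layer 0 => D q.1 q.2)
      {q : X.layer 1 × X.layer 0 | X.bond (Nat.zero_le 1) q.1 ∈ U} := h.scZero.continuousOn

/-- The derivative at a point of `X_{m+1}` restricts to the layers of index at most `m`. -/
lemma HasScDeriv.exists_layer (h : HasScDeriv X Y U f D) {m : ℕ} {x : X.layer 1}
    (hx : X.bond (Nat.zero_le 1) x ∈ U)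
    (hm : x ∈ range (X.bond (Nat.succ_le_succ (Nat.zero_le m)))) :
    ∃ L : X.layer m →L[ℝ] Y.layer m, ∀ v,
      Y.bond (Nat.zero_le m) (L v) = D x (X.bond (Nat.zero_le m) v) := by
  obtain ⟨z, rfl⟩ := hm
  obtain ⟨g, hg, hgD⟩ := h.scZero m
  have hz : ∀ v : X.layer m, X.tangent.bond (Nat.zero_le m)
      ((z, v) : X.layer (m + 1) × X.layer m) ∈ tangentSet X U := fun v => hx
  have hb : ∀ v : X.layer m, Y.bond (Nat.zero_le m) (g ((z, v) : X.layer (m + 1) × X.layer m)) =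
      D (X.bond (Nat.succ_le_succ (Nat.zero_le m)) z) (X.bond (Nat.zero_le m) v) :=
    fun v => hgD _ (hz v)
  have hinj := Y.bond_injective (Nat.zero_le m)
  -- The restriction of `g` to the slice over `z` is continuous; its linearity is checked in `Y_0`,
  -- where it agrees with `D x`.
  refine ⟨⟨⟨⟨fun v => g ((z, v) : X.layer (m + 1) × X.layer m), fun a b => hinj ?_⟩,
    fun c a => hinj ?_⟩, ?_⟩, hb⟩
  · simp only [map_add, hb]
  · simp only [map_smul, hb, RingHom.id_apply]
  · have hc : Continuous fun v : X.layer m => ((z, v) : X.layer (m + 1) × X.layer m) := by fun_prop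
    exact hg.comp_continuous hc hz

/-- The derivative of `f` along `X_1` factors through the compact map `X_1 → X_0`, and the sc^0
property of the outer derivative supplies joint continuity; these are the hypotheses of
`hasFDerivAt_comp_of_isCompactOperator`. -/
lemma HasScDeriv.comp (hg : HasScDeriv Y Z W g B) (hf : HasScDeriv X Y U f D)
    {f₁ : X.layer 1 → Y.layer 1} (hf₁ : ∀ x, X.bond (Nat.zero_le 1) x ∈ U →
      Y.bond (Nat.zero_le 1) (f₁ x) = f (X.bond (Nat.zero_le 1) x))
    (hU : IsOpen U) (hW : IsOpen W) (hm : MapsTo f U W) (hf0 : IsScZero X Y U f)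
    (hT : IsScZero X.tangent Y.tangent (tangentSet X U)
      (fun q : X.layer 1 × X.layer 0 => ((f₁ q.1, D q.1 q.2) : Y.layer 1 × Y.layer 0))) :
    HasScDeriv X Z U (g ∘ f) fun x => (B (f₁ x)).comp (D x) where
  scZero := hg.scZero.comp hT fun q hq => by
    have h1 := hf₁ _ hq
    have h2 : f (X.bond (Nat.zero_le 1) (show X.layer 1 × X.layer 0 from q).1) ∈ W := hm hq
    rw [← h1] at h2
    exact h2
  frechet x hx := by
    have hU1 := X.isOpen_preimage_bond hU 1
    have hW1 := Y.isOpen_preimage_bond hW 1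
    have hy : Y.bond (Nat.zero_le 1) (f₁ x) ∈ W := by rw [hf₁ x hx]; exact hm hx
    have hev : ∀ᶠ y in 𝓝 x, X.bond (Nat.zero_le 1) y ∈ U := hU1.mem_nhds hx
    have hf₁c : ContinuousAt f₁ x := by
      refine ((hf0.continuousOn_lift 1).continuousAt (hU1.mem_nhds hx)).congr ?_
      filter_upwards [hev] with y hy
      rw [← hf₁ y hy, Y.lift_bond]
    have hd : HasFDerivAt (fun y => Y.bond (Nat.zero_le 1) (f₁ y))
        ((D x).comp (X.bond (Nat.zero_le 1))) x :=
      (hf.frechet x hx).congr_of_eventuallyEq (by filter_upwards [hev] with y hy using hf₁ y hy)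
    have hcomp : IsCompactOperator ((D x).comp (X.bond (Nat.zero_le 1))) :=
      (X.bond_compact Nat.zero_lt_one).clm_comp (D x)
    have := hasFDerivAt_comp_of_isCompactOperator
      (g := fun y => g (Y.bond (Nat.zero_le 1) y)) (B := B) hcomp hf₁c hd
      (by filter_upwards [hW1.mem_nhds hy] with y hy using hg.frechet y hy)
      (fun η => hg.continuousOn.continuousAt
        ((hW1.preimage continuous_fst).mem_nhds (x := (f₁ x, η)) hy))
    refine this.congr_of_eventuallyEq ?_
    filter_upwards [hev] with y hy
    simp only [Function.comp_apply, hf₁ y hy]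

end ScDeriv

/-! ### Higher differentiability, linear maps and tangent maps -/

section IsSc

variable {X : BanachScale.{u} ℕ} {Y : BanachScale.{v} ℕ} {Z : BanachScale.{w} ℕ}
  {U V : Set (X.layer 0)} {W : Set (Y.layer 0)} {f f' : X.layer 0 → Y.layer 0}
  {g : Y.layer 0 → Z.layer 0}

lemma IsSc.isScZero {k : ℕ} (h : IsSc k X Y U f) : IsScZero X Y U f := by
  cases k with
  | zero => exact h
  | succ k => exact h.1

lemma IsSc.mono {k : ℕ} (h : IsSc k X Y U f) (hV : V ⊆ U) : IsSc k X Y V f := by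
  induction k generalizing X Y with
  | zero => exact IsScZero.mono h hV
  | succ k ih =>
    obtain ⟨h0, f₁, D, hf₁, hD, hT⟩ := h
    exact ⟨h0.mono hV, f₁, D, fun x hx => hf₁ x (hV hx), hD.mono hV, ih hT fun _ hx => hV hx⟩

lemma IsSc.congr {k : ℕ} (h : IsSc k X Y U f) (hU : IsOpen U) (hf : EqOn f f' U) :
    IsSc k X Y U f' := by
  cases k with
  | zero => exact IsScZero.congr h hf
  | succ k =>
    obtain ⟨h0, f₁, D, hf₁, hD, hT⟩ := h
    exact ⟨h0.congr hf, f₁, D, fun x hx => (hf₁ x hx).trans (hf hx), hD.congr hU hf, hT⟩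

/-- Chain rule of scale calculus. -/
theorem IsSc.comp {k : ℕ} (hg : IsSc k Y Z W g) (hf : IsSc k X Y U f) (hU : IsOpen U)
    (hW : IsOpen W) (hm : MapsTo f U W) : IsSc k X Z U (g ∘ f) := by
  induction k generalizing X Y Z with
  | zero => exact IsScZero.comp hg hf hm
  | succ k ih =>
    obtain ⟨hf0, f₁, D, hf₁, hD, hTf⟩ := hf
    obtain ⟨hg0, g₁, B, hg₁, hB, hTg⟩ := hg
    have hy : ∀ x, X.bond (Nat.zero_le 1) x ∈ U → Y.bond (Nat.zero_le 1) (f₁ x) ∈ W :=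
      fun x hx => by rw [hf₁ x hx]; exact hm hx
    refine ⟨hg0.comp hf0 hm, g₁ ∘ f₁, fun x => (B (f₁ x)).comp (D x), fun x hx => ?_,
      hB.comp hD hf₁ hU hW hm hf0 hTf.isScZero, ?_⟩
    · rw [Function.comp_apply, hg₁ _ (hy x hx), hf₁ x hx, Function.comp_apply]
    -- The tangent map of the composite is by definition the composite of the tangent maps, so the
    -- induction runs on tangent scales.
    · exact ih hTg hTf (isOpen_tangentSet hU) (isOpen_tangentSet hW) fun q hq => hy _ hq

lemma IsScSmooth.mono (h : IsScSmooth X Y U f) (hV : V ⊆ U) : IsScSmooth X Y V f :=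
  fun k => (h k).mono hV

lemma IsScSmooth.congr (h : IsScSmooth X Y U f) (hU : IsOpen U) (hf : EqOn f f' U) :
    IsScSmooth X Y U f' := fun k => (h k).congr hU hf

lemma IsScSmooth.comp (hg : IsScSmooth Y Z W g) (hf : IsScSmooth X Y U f) (hU : IsOpen U)
    (hW : IsOpen W) (hm : MapsTo f U W) : IsScSmooth X Z U (g ∘ f) :=
  fun k => (hg k).comp (hf k) hU hW hm

lemma IsScSmooth.isScZero (h : IsScSmooth X Y U f) : IsScZero X Y U f := h 0

lemma IsScSmooth.hasScDeriv (h : IsScSmooth X Y U f) :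
    HasScDeriv X Y U f (scDeriv X Y U f) := by
  obtain ⟨_, _, D, _, hD, _⟩ := h 1
  exact hD.hasScDeriv_scDeriv

/-- A continuous linear map of scales. -/
structure ScLinear (X : BanachScale.{u} ℕ) (Y : BanachScale.{v} ℕ) where
  map : ∀ m, X.layer m →L[ℝ] Y.layer m
  bond_map : ∀ m x, Y.bond (Nat.zero_le m) (map m x) = map 0 (X.bond (Nat.zero_le m) x)

/-- The derivative of a linear map of scales is sc-linear. -/
def ScLinear.tangent (L : ScLinear X Y) : ScLinear X.tangent Y.tangent where
  map m := (L.map (m + 1)).prodMap (L.map m)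
  bond_map m x := by
    obtain ⟨a, b⟩ : X.layer (m + 1) × X.layer m := x
    refine Prod.ext (Y.bond_injective (Nat.zero_le 1) ?_) (L.bond_map m b)
    change Y.bond (Nat.zero_le 1) (Y.bond (Nat.succ_le_succ (Nat.zero_le m)) (L.map (m + 1) a)) =
      Y.bond (Nat.zero_le 1) (L.map 1 (X.bond (Nat.succ_le_succ (Nat.zero_le m)) a))
    rw [Y.bond_bond, L.bond_map, L.bond_map, X.bond_bond]

lemma ScLinear.isScZero (L : ScLinear X Y) : IsScZero X Y U (L.map 0) :=
  fun m => ⟨L.map m, (L.map m).continuous.continuousOn, fun x _ => L.bond_map m x⟩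

lemma ScLinear.hasScDeriv (L : ScLinear X Y) : HasScDeriv X Y U (L.map 0) fun _ => L.map 0 where
  scZero m := by
    refine ⟨fun x => L.map m (show X.layer (m + 1) × X.layer m from x).2, ?_, fun x _ =>
      L.bond_map m _⟩
    exact ((L.map m).continuous.comp
      (continuous_snd (X := X.layer (m + 1)) (Y := X.layer m))).continuousOn
  frechet x _ := ((L.map 0).comp (X.bond (Nat.zero_le 1))).hasFDerivAt

/-- The tangent map of a linear map is again linear, namely `L.tangent`, so induction on the order
applies. -/
lemma ScLinear.isScSmooth (L : ScLinear X Y) : IsScSmooth X Y U (L.map 0) := by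
  intro k
  induction k generalizing X Y with
  | zero => exact L.isScZero
  | succ k ih =>
    exact ⟨L.isScZero, L.map 1, fun _ => L.map 0, fun x _ => L.bond_map 1 x, L.hasScDeriv,
      ih L.tangent⟩

/-- The identity as an sc-linear map. -/
def ScLinear.id (X : BanachScale.{u} ℕ) : ScLinear X X where
  map _ := ContinuousLinearMap.id ℝ _
  bond_map _ _ := rfl

/-- The projection of a product of scales to its first factor. -/
def ScLinear.fst (X : BanachScale.{u} ℕ) (Y : BanachScale.{v} ℕ) : ScLinear (X.prod Y) X where
  map m := ContinuousLinearMap.fst ℝ (X.layer m) (Y.layer m)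
  bond_map _ _ := rfl

/-- The inclusion of the first factor of a product of scales. -/
def ScLinear.inl (X : BanachScale.{u} ℕ) (Y : BanachScale.{v} ℕ) : ScLinear X (X.prod Y) where
  map m := ContinuousLinearMap.inl ℝ (X.layer m) (Y.layer m)
  bond_map m _ := Prod.ext rfl (map_zero (Y.bond (Nat.zero_le m)))

/-- The tangent map `T f` of an sc-smooth map. -/
def scTangentMap (X : BanachScale.{u} ℕ) (Y : BanachScale.{v} ℕ) (U : Set (X.layer 0))
    (f : X.layer 0 → Y.layer 0) (q : X.tangent.layer 0) : Y.tangent.layer 0 :=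
  ((Y.lift 1 (f (X.bond (Nat.zero_le 1) (show X.layer 1 × X.layer 0 from q).1)),
    scDeriv X Y U f (show X.layer 1 × X.layer 0 from q).1 (show X.layer 1 × X.layer 0 from q).2) :
      Y.layer 1 × Y.layer 0)

/-- Each order comes with its own witnesses for the restriction and the derivative. By uniqueness
they all agree over `U` with the fixed choices in `scTangentMap`, so one map has every order. -/
lemma IsScSmooth.tangentMap (h : IsScSmooth X Y U f) (hU : IsOpen U) :
    IsScSmooth X.tangent Y.tangent (tangentSet X U) (scTangentMap X Y U f) := fun k => by
  obtain ⟨_, f₁, D, hf₁, hD, hT⟩ := h (k + 1)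
  refine hT.congr (isOpen_tangentSet hU) fun q hq => Prod.ext ?_ ?_
  · change f₁ _ = Y.lift 1 _
    rw [← hf₁ _ hq, Y.lift_bond]
  · change D _ _ = scDeriv X Y U f _ _
    rw [hD.scDeriv_eq hq]

/-- An sc-smooth map restricts to an sc-smooth map of the shifted scales. -/
lemma IsScSmooth.shift (h : IsScSmooth X Y U f) (hU : IsOpen U) :
    IsScSmooth X.shift Y.shift {x : X.layer 1 | X.bond (Nat.zero_le 1) x ∈ U}
      (fun x : X.layer 1 => Y.lift 1 (f (X.bond (Nat.zero_le 1) x))) := by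
  have hV : IsOpen (X := X.shift.layer 0) {x : X.layer 1 | X.bond (Nat.zero_le 1) x ∈ U} :=
    X.isOpen_preimage_bond hU 1
  -- The restriction to layer 1 is the tangent map preceded by the zero section and followed by the
  -- first projection.
  have h1 := (h.tangentMap hU).comp ((ScLinear.inl X.shift X).isScSmooth) hV
    (isOpen_tangentSet hU) fun x (hx : X.bond (Nat.zero_le 1) x ∈ U) => hx
  have h2 := ((ScLinear.fst Y.shift Y).isScSmooth (U := univ)).comp h1 hV isOpen_univ
    fun x _ => mem_univ _
  exact h2.congr hV fun x _ => rfl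

/-- The derivative of a composition, with arbitrary domains for the derivatives involved. -/
lemma scDeriv_comp {O : Set (X.layer 0)} {h : X.layer 0 → Z.layer 0} (hO : IsOpen O)
    (hgW : IsScSmooth Y Z W g) (hfU : IsScSmooth X Y U f) (hU : IsOpen U) (hW : IsOpen W)
    (hh : ∃ D, HasScDeriv X Z O h D)
    {x : X.layer 1} (hxO : X.bond (Nat.zero_le 1) x ∈ O) (hxU : X.bond (Nat.zero_le 1) x ∈ U)
    (hxW : f (X.bond (Nat.zero_le 1) x) ∈ W)
    (heq : ∀ y ∈ O, y ∈ U → f y ∈ W → h y = g (f y)) (v : X.layer 0) :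
    scDeriv X Z O h x v = scDeriv Y Z W g (Y.lift 1 (f (X.bond (Nat.zero_le 1) x)))
      (scDeriv X Y U f x v) := by
  obtain ⟨D, hD⟩ := hh
  -- The chain rule holds on the common domain `O ∩ (U ∩ f ⁻¹' W)`; uniqueness then transfers it to
  -- derivatives taken on the larger sets.
  have hV : IsOpen (U ∩ f ⁻¹' W) := hfU.isScZero.continuousOn.isOpen_inter_preimage hU hW
  have hf' := hfU.mono (V := O ∩ (U ∩ f ⁻¹' W)) fun y hy => hy.2.1
  obtain ⟨hf0, f₁, A, hf₁, hA, hTf⟩ := hf' 1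
  have hc := hgW.hasScDeriv.comp hA hf₁ (hO.inter hV) hW (fun y hy => hy.2.2) hf0 hTf.isScZero
  have hx : X.bond (Nat.zero_le 1) x ∈ O ∩ (U ∩ f ⁻¹' W) := ⟨hxO, hxU, hxW⟩
  have h1 := (hc.congr (hO.inter hV) (f' := h)
    fun y hy => (heq y hy.1 hy.2.1 hy.2.2).symm).unique hD hx hxO
  rw [hD.scDeriv_eq hxO, ← h1, ← hf₁ x hx, Y.lift_bond, hfU.hasScDeriv.unique hA hxU hx]
  rfl

end IsSc

/-! ### Constructing charts and atlases -/

/-- A family of partial bijections with continuous transition maps between open sets consists of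
charts for the topology that it generates. -/
lemma exists_openPartialHomeomorph {M H ι : Type*} [TopologicalSpace H] [t : TopologicalSpace M]
    (e : ι → PartialEquiv M H)
    (ht : t = TopologicalSpace.generateFrom
      {s | ∃ i, ∃ W : Set H, IsOpen W ∧ s = {p | p ∈ (e i).source ∧ e i p ∈ W}})
    (ho : ∀ i j, IsOpen ((e i).symm.trans (e j)).source)
    (hc : ∀ i j, ContinuousOn ((e i).symm.trans (e j)) ((e i).symm.trans (e j)).source) (i : ι) :
    ∃ Φ : OpenPartialHomeomorph M H, Φ.toPartialEquiv = e i := by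
  have hW : ∀ i (W : Set H), IsOpen W → IsOpen {p | p ∈ (e i).source ∧ e i p ∈ W} := by
    intro i W hW
    rw [ht]
    exact TopologicalSpace.isOpen_generateFrom_of_mem ⟨i, W, hW, rfl⟩
  have hs : IsOpen (e i).source := by
    convert hW i univ isOpen_univ using 1
    ext p; exact ⟨fun h => ⟨h, mem_univ _⟩, fun h => h.1⟩
  -- The target is the domain of the transition map from `e i` to itself.
  have htg : IsOpen (e i).target := by
    convert ho i i using 1
    ext x
    rw [PartialEquiv.trans_source]
    exact ⟨fun h => ⟨h, (e i).map_target h⟩, fun h => h.1⟩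
  refine ⟨⟨⟨e i, ?_, ?_⟩, hs, htg⟩, rfl⟩
  · rw [continuousOn_open_iff hs]
    exact fun W hWo => hW i W hWo
  · subst ht
    rw [continuousOn_to_generateFrom_iff]
    rintro x hx _ ⟨j, W, hWo, rfl⟩ hxs
    -- Pulled back by the inverse of `e i`, a generating set of the topology is the preimage of `W`
    -- under a transition map.
    have h1 := (hc i j).isOpen_inter_preimage (ho i j) hWo
    refine mem_nhdsWithin_of_mem_nhds (mem_of_superset (h1.mem_nhds ⟨?_, hxs.2⟩) ?_)
    · rw [PartialEquiv.trans_source]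
      exact ⟨hx, hxs.1⟩
    · rintro y ⟨hy, hyW⟩
      rw [PartialEquiv.trans_source] at hy
      exact ⟨hy.2, hyW⟩

lemma mem_symm_trans_source {M H H' : Type*} [TopologicalSpace M] [TopologicalSpace H]
    [TopologicalSpace H'] {φ : OpenPartialHomeomorph M H} {ψ : OpenPartialHomeomorph M H'} {x : H} :
    x ∈ (φ.symm.trans ψ).source ↔ x ∈ φ.target ∧ φ.symm x ∈ ψ.source := by
  rw [OpenPartialHomeomorph.trans_source]; rfl

lemma apply_mem_symm_trans_source {M H H' : Type*} [TopologicalSpace M] [TopologicalSpace H]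
    [TopologicalSpace H'] {φ : OpenPartialHomeomorph M H} {ψ : OpenPartialHomeomorph M H'} {p : M}
    (h : p ∈ φ.source) (h' : p ∈ ψ.source) : φ p ∈ (φ.symm.trans ψ).source :=
  mem_symm_trans_source.2 ⟨φ.map_source h, by rwa [φ.left_inv h]⟩

lemma symm_trans_apply {M H H' : Type*} [TopologicalSpace M] [TopologicalSpace H]
    [TopologicalSpace H'] {φ : OpenPartialHomeomorph M H} {ψ : OpenPartialHomeomorph M H'} {p : M}
    (h : p ∈ φ.source) : (φ.symm.trans ψ) (φ p) = ψ p := by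
  rw [OpenPartialHomeomorph.coe_trans, Function.comp_apply, φ.left_inv h]

/-- Every `sc^∞`-atlas is contained in a maximal one. -/
lemma IsScAtlas.exists_scManifold {X : BanachScale.{u} ℕ} {M : Type v} [TopologicalSpace M]
    [T2Space M] {A : Set (OpenPartialHomeomorph M (X.layer 0))} (hA : IsScAtlas X M A) :
    ∃ 𝓜 : ScManifold X M, A ⊆ 𝓜.atlas := by
  obtain ⟨B, hAB, hB⟩ := zorn_subset_nonempty {A | IsScAtlas X M A} (by
    intro c hc hchain hne
    refine ⟨⋃₀ c, ⟨fun p => ?_, ?_⟩, fun s hs => subset_sUnion_of_mem hs⟩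
    · obtain ⟨s, hs⟩ := hne
      obtain ⟨φ, hφ, hp⟩ := (hc hs).cover p
      exact ⟨φ, ⟨s, hs, hφ⟩, hp⟩
    · rintro φ ⟨s, hs, hφ⟩ ψ ⟨t, ht, hψ⟩
      rcases hchain.total hs ht with h | h
      · exact (hc ht).compatible φ (h hφ) ψ hψ
      · exact (hc hs).compatible φ hφ ψ (h hψ)) A hA
  exact ⟨⟨inferInstance, B, hB⟩, hAB⟩

/-! ### Levels of a manifold and tangent spaces -/

namespace ScManifold

variable {X : BanachScale.{u} ℕ} {M : Type v} [TopologicalSpace M] (𝓜 : ScManifold X M)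
  {φ ψ χ : OpenPartialHomeomorph M (X.layer 0)} {p : M} {m : ℕ}

lemma isScSmooth_transition (hφ : φ ∈ 𝓜.atlas) (hψ : ψ ∈ 𝓜.atlas) :
    IsScSmooth X X (φ.symm.trans ψ).source (φ.symm.trans ψ) :=
  (𝓜.maximal.prop.compatible φ hφ ψ hψ).1

lemma exists_chart (p : M) : ∃ φ ∈ 𝓜.atlas, p ∈ φ.source := 𝓜.maximal.prop.cover p

/-- Transition maps preserve `X_m`, so a single chart decides membership. -/
lemma mem_level_iff (hφ : φ ∈ 𝓜.atlas) (hp : p ∈ φ.source) :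
    p ∈ 𝓜.level m ↔ φ p ∈ range (X.bond (Nat.zero_le m)) := by
  refine ⟨fun ⟨ψ, hψ, hpψ, h⟩ => ?_, fun h => ⟨φ, hφ, hp, h⟩⟩
  have := (𝓜.isScSmooth_transition hψ hφ).isScZero.mem_range
    (apply_mem_symm_trans_source hpψ hp) h
  rwa [symm_trans_apply hpψ] at this

lemma level_anti {k : ℕ} (h : k ≤ m) : 𝓜.level m ⊆ 𝓜.level k :=
  fun _ ⟨φ, hφ, hp, hr⟩ => ⟨φ, hφ, hp, X.range_bond_subset h (Nat.zero_le k) hr⟩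

/-- The image of `X_m` is dense in `X_0` and therefore meets the open target of any chart around a
point. -/
lemma nonempty_level (h : Nonempty M) (m : ℕ) : Nonempty (𝓜.Level m) := by
  obtain ⟨p⟩ := h
  obtain ⟨φ, hφ, hp⟩ := 𝓜.exists_chart p
  obtain ⟨y, hx⟩ := (X.denseRange_bond (Nat.zero_le m)).exists_mem_open
    φ.open_target ⟨_, φ.map_source hp⟩
  refine ⟨⟨φ.symm (X.bond (Nat.zero_le m) y), φ, hφ, φ.map_target hx, ?_⟩⟩
  rw [φ.right_inv hx]
  exact ⟨y, rfl⟩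

lemma bijOn_levelChart (hφ : φ ∈ 𝓜.atlas) (m : ℕ) :
    BijOn (fun p : 𝓜.Level m => X.lift m (φ p.pt)) {p | p.pt ∈ φ.source}
      {x | X.bond (Nat.zero_le m) x ∈ φ.target} := by
  have hb : ∀ p : 𝓜.Level m, p.pt ∈ φ.source →
      X.bond (Nat.zero_le m) (X.lift m (φ p.pt)) = φ p.pt :=
    fun p hp => X.bond_lift ((𝓜.mem_level_iff hφ hp).1 p.mem)
  refine ⟨fun p hp => ?_, fun p hp q hq h => ?_, fun x hx => ?_⟩
  · change X.bond (Nat.zero_le m) (X.lift m (φ p.pt)) ∈ φ.target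
    rw [hb p hp]
    exact φ.map_source hp
  · have h1 := congrArg (X.bond (Nat.zero_le m)) h
    simp only [hb p hp, hb q hq] at h1
    exact Level.ext (φ.injOn hp hq h1)
  · have hx' : X.bond (Nat.zero_le m) x ∈ φ.target := hx
    have hs := φ.map_target hx'
    refine ⟨⟨φ.symm (X.bond (Nat.zero_le m) x), (𝓜.mem_level_iff hφ hs).2 ?_⟩, hs, ?_⟩
    · rw [φ.right_inv hx']
      exact ⟨x, rfl⟩
    · change X.lift m (φ (φ.symm _)) = x
      rw [φ.right_inv hx', X.lift_bond]

/-- The chart `U_m → X_m` induced by a chart `U → X_0`. -/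
lemma exists_levelChart (hφ : φ ∈ 𝓜.atlas) (m : ℕ) :
    ∃ Φ : OpenPartialHomeomorph (𝓜.Level m) (X.layer m),
      Φ.source = {p | p.pt ∈ φ.source} ∧ Φ.target = {x | X.bond (Nat.zero_le m) x ∈ φ.target} ∧
      (∀ p, Φ p = X.lift m (φ p.pt)) ∧
      ∀ p ∈ Φ.source, X.bond (Nat.zero_le m) (Φ p) = φ p.pt := by
  -- The total function `φ.symm` provides a point of `M`, even when `φ` has empty source;
  -- nonemptiness is needed to define the inverses in `e`.
  have hne : Nonempty (𝓜.Level m) := 𝓜.nonempty_level ⟨φ.symm 0⟩ m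
  let e : 𝓜.atlas → PartialEquiv (𝓜.Level m) (X.layer m) := fun φ =>
    (𝓜.bijOn_levelChart φ.2 m).toPartialEquiv
  have hb : ∀ (i : 𝓜.atlas) (p : 𝓜.Level m), p.pt ∈ i.1.source →
      X.bond (Nat.zero_le m) (X.lift m (i.1 p.pt)) = i.1 p.pt :=
    fun i p hp => X.bond_lift ((𝓜.mem_level_iff i.2 hp).1 p.mem)
  have hsymm : ∀ (i : 𝓜.atlas) (x : X.layer m), X.bond (Nat.zero_le m) x ∈ i.1.target →
      ((e i).symm x).pt = i.1.symm (X.bond (Nat.zero_le m) x) := by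
    intro i x hx
    have h1 : ((e i).symm x).pt ∈ i.1.source := (e i).map_target hx
    have h2 : X.lift m (i.1 ((e i).symm x).pt) = x := (e i).right_inv hx
    rw [← h2, hb i _ h1, i.1.left_inv h1, h2]
  have hsrc : ∀ i j, ((e i).symm.trans (e j)).source =
      {x | X.bond (Nat.zero_le m) x ∈ (i.1.symm.trans j.1).source} := by
    intro i j
    ext x
    rw [PartialEquiv.trans_source]
    change X.bond (Nat.zero_le m) x ∈ i.1.target ∧ ((e i).symm x).pt ∈ j.1.source ↔
      X.bond (Nat.zero_le m) x ∈ (i.1.symm.trans j.1).source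
    rw [mem_symm_trans_source]
    exact and_congr_right fun h => by rw [hsymm i x h]
  obtain ⟨Φ, hΦ⟩ := exists_openPartialHomeomorph e (by
      refine congrArg TopologicalSpace.generateFrom (Set.ext fun s => ⟨?_, ?_⟩)
      · rintro ⟨φ, hφ, W, hW, rfl⟩
        refine ⟨⟨φ, hφ⟩, W, hW, Set.ext fun p => and_congr_right fun hp => ⟨?_, fun h => ?_⟩⟩
        · rintro ⟨x, hx, hxp⟩
          change X.lift m (φ p.pt) ∈ W
          rwa [← hxp, X.lift_bond]
        · exact ⟨_, h, hb ⟨φ, hφ⟩ p hp⟩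
      · rintro ⟨⟨φ, hφ⟩, W, hW, rfl⟩
        refine ⟨φ, hφ, W, hW, Set.ext fun p => and_congr_right fun hp => ⟨fun h => ?_, ?_⟩⟩
        · exact ⟨_, h, hb ⟨φ, hφ⟩ p hp⟩
        · rintro ⟨x, hx, hxp⟩
          change X.lift m (φ p.pt) ∈ W
          rwa [← hxp, X.lift_bond])
    (fun i j => by
      rw [hsrc]
      exact X.isOpen_preimage_bond (i.1.symm.trans j.1).open_source m)
    (fun i j => by
      rw [hsrc]
      refine ((𝓜.isScSmooth_transition i.2 j.2).isScZero.continuousOn_lift m).congr fun x hx => ?_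
      change X.lift m (j.1 ((e i).symm x).pt) = X.lift m (j.1 (i.1.symm _))
      rw [hsymm i x (mem_symm_trans_source.1 hx).1]) ⟨φ, hφ⟩
  have hs : Φ.source = {p | p.pt ∈ φ.source} := congrArg PartialEquiv.source hΦ
  have hf : ∀ p, Φ p = X.lift m (φ p.pt) := fun p =>
    congrFun (congrArg (fun e : PartialEquiv (𝓜.Level m) (X.layer m) => (e : 𝓜.Level m → X.layer m)) hΦ) p
  refine ⟨Φ, hs, congrArg PartialEquiv.target hΦ, hf, fun p hp => ?_⟩
  rw [hs] at hp
  rw [hf]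
  exact hb ⟨φ, hφ⟩ p hp

/-- In charts this is the bonding map `X_m → X_0`. The Hausdorff property passes to the levels along
it. -/
lemma continuous_pt (m : ℕ) : Continuous (Level.pt : 𝓜.Level m → M) := by
  rw [continuous_iff_continuousAt]
  intro p
  obtain ⟨φ, hφ, hp⟩ := 𝓜.exists_chart p.pt
  obtain ⟨Φ, hs, -, -, hb⟩ := 𝓜.exists_levelChart hφ m
  have hpΦ : p ∈ Φ.source := by rw [hs]; exact hp
  have h1 : ContinuousAt (fun q => φ.symm (X.bond (Nat.zero_le m) (Φ q))) p := by
    refine ContinuousAt.comp (g := φ.symm) ?_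
      ((X.bond (Nat.zero_le m)).continuous.continuousAt.comp (Φ.continuousAt hpΦ))
    refine φ.symm.continuousAt ?_
    rw [hb p hpΦ]
    exact φ.map_source hp
  refine h1.congr ?_
  filter_upwards [Φ.open_source.mem_nhds hpΦ] with q hq
  rw [hb q hq, φ.left_inv]
  rw [hs] at hq
  exact hq

instance (m : ℕ) : T2Space (𝓜.Level m) :=
  haveI := 𝓜.t2
  T2Space.of_injective_continuous (fun _ _ h => Level.ext h) (𝓜.continuous_pt m)

/-! ### Tangent spaces -/

lemma bond_lift_one (hφ : φ ∈ 𝓜.atlas) (hp : p ∈ φ.source) (h1 : p ∈ 𝓜.level 1) :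
    X.bond (Nat.zero_le 1) (X.lift 1 (φ p)) = φ p :=
  X.bond_lift ((𝓜.mem_level_iff hφ hp).1 h1)

lemma bond_chartDeriv (φ ψ : 𝓜.ChartAt p) (v : 𝓜.TangentSpace p m) :
    X.bond (Nat.zero_le m) (𝓜.chartDeriv ψ m v) =
      scDeriv X X (φ.1.symm.trans ψ.1).source (φ.1.symm.trans ψ.1) (X.lift 1 (φ.1 p))
        (X.bond (Nat.zero_le m) (𝓜.chartDeriv φ m v)) := v.2 φ ψ

lemma scDeriv_transition_self (hφ : φ ∈ 𝓜.atlas) (hp : p ∈ φ.source) (h1 : p ∈ 𝓜.level 1)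
    (v : X.layer 0) : scDeriv X X (φ.symm.trans φ).source (φ.symm.trans φ) (X.lift 1 (φ p)) v = v := by
  have hs : X.bond (Nat.zero_le 1) (X.lift 1 (φ p)) ∈ (φ.symm.trans φ).source := by
    rw [𝓜.bond_lift_one hφ hp h1]
    exact apply_mem_symm_trans_source hp hp
  have h2 : HasScDeriv X X (φ.symm.trans φ).source (φ.symm.trans φ) fun _ =>
      (ScLinear.id X).map 0 :=
    (ScLinear.id X).hasScDeriv.congr (φ.symm.trans φ).open_source fun x hx =>
      (φ.right_inv (mem_symm_trans_source.1 hx).1).symm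
  rw [h2.scDeriv_eq hs]
  rfl

/-- The cocycle rule for tangent vectors. The three transition maps have different domains, hence
the form of `scDeriv_comp`. -/
lemma scDeriv_transition_comp (hφ : φ ∈ 𝓜.atlas) (hψ : ψ ∈ 𝓜.atlas) (hχ : χ ∈ 𝓜.atlas)
    (hpφ : p ∈ φ.source) (hpψ : p ∈ ψ.source) (hpχ : p ∈ χ.source) (h1 : p ∈ 𝓜.level 1)
    (v : X.layer 0) :
    scDeriv X X (φ.symm.trans χ).source (φ.symm.trans χ) (X.lift 1 (φ p)) v =
      scDeriv X X (ψ.symm.trans χ).source (ψ.symm.trans χ) (X.lift 1 (ψ p))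
        (scDeriv X X (φ.symm.trans ψ).source (φ.symm.trans ψ) (X.lift 1 (φ p)) v) := by
  have hb := 𝓜.bond_lift_one hφ hpφ h1
  have := scDeriv_comp (φ.symm.trans χ).open_source (𝓜.isScSmooth_transition hψ hχ)
    (𝓜.isScSmooth_transition hφ hψ) (φ.symm.trans ψ).open_source (ψ.symm.trans χ).open_source
    ⟨_, (𝓜.isScSmooth_transition hφ hχ).hasScDeriv⟩ (x := X.lift 1 (φ p))
    (by rw [hb]; exact apply_mem_symm_trans_source hpφ hpχ)
    (by rw [hb]; exact apply_mem_symm_trans_source hpφ hpψ)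
    (by rw [hb, symm_trans_apply hpφ]; exact apply_mem_symm_trans_source hpψ hpχ)
    (fun y _ hy _ => by
      simp only [OpenPartialHomeomorph.coe_trans, Function.comp_apply]
      rw [ψ.left_inv (mem_symm_trans_source.1 hy).2]) v
  rwa [hb, symm_trans_apply hpφ] at this

/-- Reading off tangent vectors of class `m` in a chart is an isomorphism. -/
lemma isInvertible_chartDeriv (φ : 𝓜.ChartAt p) (hp : p ∈ 𝓜.level (m + 1)) :
    (𝓜.chartDeriv φ m).IsInvertible := by
  have h1 : p ∈ 𝓜.level 1 := 𝓜.level_anti (Nat.succ_le_succ (Nat.zero_le m)) hp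
  have hL : ∀ ψ : 𝓜.ChartAt p, ∃ L : X.layer m →L[ℝ] X.layer m, ∀ v,
      X.bond (Nat.zero_le m) (L v) = scDeriv X X (φ.1.symm.trans ψ.1).source
        (φ.1.symm.trans ψ.1) (X.lift 1 (φ.1 p)) (X.bond (Nat.zero_le m) v) := by
    intro ψ
    refine (𝓜.isScSmooth_transition φ.2.1 ψ.2.1).hasScDeriv.exists_layer ?_ ?_
    · rw [𝓜.bond_lift_one φ.2.1 φ.2.2 h1]
      exact apply_mem_symm_trans_source φ.2.2 ψ.2.2
    · obtain ⟨z, hz⟩ := (𝓜.mem_level_iff φ.2.1 φ.2.2).1 hp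
      refine ⟨z, X.bond_injective (Nat.zero_le 1) ?_⟩
      rw [X.bond_bond, 𝓜.bond_lift_one φ.2.1 φ.2.2 h1, hz]
  choose L hL using hL
  have hmem : ∀ v, (fun ψ => L ψ v) ∈ 𝓜.tangentSubmodule p m := fun v ψ χ => by
    rw [hL, hL]
    exact 𝓜.scDeriv_transition_comp φ.2.1 ψ.2.1 χ.2.1 φ.2.2 ψ.2.2 χ.2.2 h1 _
  -- The inverse extends a vector given in the chart `φ` to all charts by the derivatives of the
  -- transition maps; the cocycle rule makes this family a tangent vector.
  let inv : X.layer m →L[ℝ] 𝓜.TangentSpace p m :=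
    (ContinuousLinearMap.pi L).codRestrict (𝓜.tangentSubmodule p m) hmem
  refine ⟨ContinuousLinearEquiv.equivOfInverse (𝓜.chartDeriv φ m) inv (fun v => ?_) fun v => ?_, rfl⟩
  · refine Subtype.ext (funext fun ψ => X.bond_injective (Nat.zero_le m) ?_)
    exact (hL ψ _).trans (𝓜.bond_chartDeriv φ ψ v).symm
  · refine X.bond_injective (Nat.zero_le m) ?_
    exact (hL φ v).trans (𝓜.scDeriv_transition_self φ.2.1 φ.2.2 h1 _)

/-! ### Derivatives of maps in charts -/

section Maps

variable {Y : BanachScale.{u} ℕ} {N : Type w} [TopologicalSpace N] {𝓢 : ScManifold Y N} {𝓜}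
  {f : M → N}

/-- Smoothness provides only one pair of charts at each point. Transition maps carry the derivative
to the given pair locally, and the local derivatives glue. -/
lemma IsScSmoothMap.exists_hasScDeriv (hf : 𝓜.IsScSmoothMap 𝓢 f)
    (hφ : φ ∈ 𝓜.atlas) {ψ : OpenPartialHomeomorph N (Y.layer 0)} (hψ : ψ ∈ 𝓢.atlas)
    (hm : MapsTo f φ.source ψ.source) :
    ∃ D, HasScDeriv X Y φ.target (ψ ∘ f ∘ φ.symm) D := by
  refine HasScDeriv.of_local φ.open_target fun x hx => ?_
  obtain ⟨φ₀, hφ₀, ψ₀, hψ₀, hp, hfp, hm₀, hs⟩ := hf.smooth (φ.symm x)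
  have h1 := hs.comp (𝓜.isScSmooth_transition hφ hφ₀) (φ.symm.trans φ₀).open_source
    φ₀.open_target fun y hy => φ₀.map_source (mem_symm_trans_source.1 hy).2
  have h2 := (𝓢.isScSmooth_transition hψ₀ hψ).comp h1 (φ.symm.trans φ₀).open_source
    (ψ₀.symm.trans ψ).open_source fun y hy => by
      have hy' := mem_symm_trans_source.1 hy
      simp only [OpenPartialHomeomorph.coe_trans, Function.comp_apply]
      rw [φ₀.left_inv hy'.2]
      exact apply_mem_symm_trans_source (hm₀ hy'.2) (hm (φ.map_target hy'.1))
  refine ⟨(φ.symm.trans φ₀).source, (φ.symm.trans φ₀).open_source,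
    mem_symm_trans_source.2 ⟨hx, hp⟩, _,
    (h2.congr (φ.symm.trans φ₀).open_source fun y hy => ?_).hasScDeriv⟩
  have hy' := mem_symm_trans_source.1 hy
  simp only [OpenPartialHomeomorph.coe_trans, Function.comp_apply]
  rw [φ₀.left_inv hy'.2, ψ₀.left_inv (hm₀ hy'.2)]

/-- The derivative of an sc-smooth map can be read off in a single pair of charts. -/
lemma IsScSmoothMap.hasDerivMap (hf : 𝓜.IsScSmoothMap 𝓢 f) (hp : p ∈ 𝓜.level 1)
    (φ₀ : 𝓜.ChartAt p) (ψ₀ : 𝓢.ChartAt (f p)) (hm₀ : MapsTo f φ₀.1.source ψ₀.1.source)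
    (hs : IsScSmooth X Y φ₀.1.target (ψ₀.1 ∘ f ∘ φ₀.1.symm))
    {L : 𝓜.TangentSpace p m →L[ℝ] 𝓢.TangentSpace (f p) m}
    (hL : ∀ v, Y.bond (Nat.zero_le m) (𝓢.chartDeriv ψ₀ m (L v)) =
      scDeriv X Y φ₀.1.target (ψ₀.1 ∘ f ∘ φ₀.1.symm) (X.lift 1 (φ₀.1 p))
        (X.bond (Nat.zero_le m) (𝓜.chartDeriv φ₀ m v))) :
    𝓜.HasDerivMap 𝓢 f p m L := by
  intro φ ψ hm v
  have hb := 𝓜.bond_lift_one φ.2.1 φ.2.2 hp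
  have hb₀ := 𝓜.bond_lift_one φ₀.2.1 φ₀.2.2 hp
  have ht := 𝓜.isScSmooth_transition φ.2.1 φ₀.2.1
  have hG := hs.comp ht (φ.1.symm.trans φ₀.1).open_source φ₀.1.open_target
    fun y hy => φ₀.1.map_source (mem_symm_trans_source.1 hy).2
  have hx : φ.1 p ∈ (φ.1.symm.trans φ₀.1).source := apply_mem_symm_trans_source φ.2.2 φ₀.2.2
  have hGx : ((ψ₀.1 ∘ f ∘ φ₀.1.symm) ∘ (φ.1.symm.trans φ₀.1)) (φ.1 p) = ψ₀.1 (f p) := by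
    simp only [OpenPartialHomeomorph.coe_trans, Function.comp_apply]
    rw [φ.1.left_inv φ.2.2, φ₀.1.left_inv φ₀.2.2]
  -- Change of the target chart; `e2` below is the change of the source chart.
  have e1 := scDeriv_comp φ.1.open_target (𝓢.isScSmooth_transition ψ₀.2.1 ψ.2.1) hG
    (φ.1.symm.trans φ₀.1).open_source (ψ₀.1.symm.trans ψ.1).open_source
    (hf.exists_hasScDeriv φ.2.1 ψ.2.1 hm) (x := X.lift 1 (φ.1 p))
    (by rw [hb]; exact φ.1.map_source φ.2.2) (by rw [hb]; exact hx)
    (by rw [hb, hGx]; exact apply_mem_symm_trans_source ψ₀.2.2 ψ.2.2)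
    (fun y hy hy' _ => by
      have hy'' := mem_symm_trans_source.1 hy'
      simp only [OpenPartialHomeomorph.coe_trans, Function.comp_apply]
      rw [φ₀.1.left_inv hy''.2, ψ₀.1.left_inv (hm₀ hy''.2)])
    (X.bond (Nat.zero_le m) (𝓜.chartDeriv φ m v))
  have e2 := scDeriv_comp (φ.1.symm.trans φ₀.1).open_source hs ht
    (φ.1.symm.trans φ₀.1).open_source φ₀.1.open_target ⟨_, hG.hasScDeriv⟩
    (x := X.lift 1 (φ.1 p)) (by rw [hb]; exact hx) (by rw [hb]; exact hx)
    (by rw [hb, symm_trans_apply φ.2.2]; exact φ₀.1.map_source φ₀.2.2)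
    (fun y _ _ _ => rfl) (X.bond (Nat.zero_le m) (𝓜.chartDeriv φ m v))
  rw [hb, hGx] at e1
  rw [hb, symm_trans_apply φ.2.2, ← 𝓜.bond_chartDeriv, ← hL] at e2
  rw [e1, e2, ← 𝓢.bond_chartDeriv]

end Maps

end ScManifold

/-! ### The shifted manifold and maps given by local representatives -/

namespace ScManifold

section Shift

variable {X : BanachScale.{u} ℕ} {M : Type v} [TopologicalSpace M] (𝓜 : ScManifold X M)
  {φ ψ : OpenPartialHomeomorph M (X.layer 0)} {m : ℕ}

/-- `Φ` is the chart `φ_m : U_m → X_m` induced by `φ`. -/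
structure IsLevelChart (φ : OpenPartialHomeomorph M (X.layer 0)) (m : ℕ)
    (Φ : OpenPartialHomeomorph (𝓜.Level m) (X.layer m)) : Prop where
  source : Φ.source = {p | p.pt ∈ φ.source}
  target : Φ.target = {x | X.bond (Nat.zero_le m) x ∈ φ.target}
  apply : ∀ p, Φ p = X.lift m (φ p.pt)
  bond_apply : ∀ p ∈ Φ.source, X.bond (Nat.zero_le m) (Φ p) = φ p.pt

variable {𝓜}

lemma IsLevelChart.mem_source {Φ : OpenPartialHomeomorph (𝓜.Level m) (X.layer m)}
    (h : 𝓜.IsLevelChart φ m Φ) {p : 𝓜.Level m} : p ∈ Φ.source ↔ p.pt ∈ φ.source := by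
  rw [h.source]; rfl

lemma IsLevelChart.mem_target {Φ : OpenPartialHomeomorph (𝓜.Level m) (X.layer m)}
    (h : 𝓜.IsLevelChart φ m Φ) {x : X.layer m} :
    x ∈ Φ.target ↔ X.bond (Nat.zero_le m) x ∈ φ.target := by
  rw [h.target]; rfl

lemma IsLevelChart.symm_pt {Φ : OpenPartialHomeomorph (𝓜.Level m) (X.layer m)}
    (h : 𝓜.IsLevelChart φ m Φ) {x : X.layer m} (hx : x ∈ Φ.target) :
    (Φ.symm x).pt = φ.symm (X.bond (Nat.zero_le m) x) := by
  have h1 := Φ.map_target hx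
  conv_rhs => rw [← Φ.right_inv hx]
  rw [h.bond_apply _ h1, φ.left_inv (h.mem_source.1 h1)]

lemma IsLevelChart.mem_transition_source {Φ Ψ : OpenPartialHomeomorph (𝓜.Level m) (X.layer m)}
    (hΦ : 𝓜.IsLevelChart φ m Φ) (hΨ : 𝓜.IsLevelChart ψ m Ψ) {x : X.layer m} :
    x ∈ (Φ.symm.trans Ψ).source ↔ X.bond (Nat.zero_le m) x ∈ (φ.symm.trans ψ).source := by
  rw [mem_symm_trans_source, mem_symm_trans_source, ← hΦ.mem_target]
  exact and_congr_right fun hx => by rw [hΨ.mem_source, hΦ.symm_pt hx]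

lemma IsLevelChart.isScSmooth_transition (hφ : φ ∈ 𝓜.atlas) (hψ : ψ ∈ 𝓜.atlas)
    {Φ Ψ : OpenPartialHomeomorph (𝓜.Level 1) (X.shift.layer 0)}
    (hΦ : 𝓜.IsLevelChart φ 1 Φ) (hΨ : 𝓜.IsLevelChart ψ 1 Ψ) :
    IsScSmooth X.shift X.shift (Φ.symm.trans Ψ).source (Φ.symm.trans Ψ) := by
  have h1 := ((𝓜.isScSmooth_transition hφ hψ).shift (φ.symm.trans ψ).open_source).mono
    fun x (hx : x ∈ (Φ.symm.trans Ψ).source) => (hΦ.mem_transition_source hΨ).1 hx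
  refine h1.congr (Φ.symm.trans Ψ).open_source fun x hx => ?_
  have hx' := (mem_symm_trans_source.1 hx).1
  exact ((hΨ.apply (Φ.symm x)).trans
    (congrArg (fun p => X.lift 1 (ψ p)) (hΦ.symm_pt hx'))).symm

variable (𝓜)

lemma exists_isLevelChart (hφ : φ ∈ 𝓜.atlas) (m : ℕ) : ∃ Φ, 𝓜.IsLevelChart φ m Φ := by
  obtain ⟨Φ, h1, h2, h3, h4⟩ := 𝓜.exists_levelChart hφ m
  exact ⟨Φ, h1, h2, h3, h4⟩

/-- The manifold `M^1`. -/
lemma exists_shift : ∃ 𝓜₁ : ScManifold X.shift (𝓜.Level 1),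
    ∀ φ ∈ 𝓜.atlas, ∃ Φ ∈ 𝓜₁.atlas, 𝓜.IsLevelChart φ 1 Φ := by
  have hA : IsScAtlas X.shift (𝓜.Level 1) {Φ | ∃ φ ∈ 𝓜.atlas, 𝓜.IsLevelChart φ 1 Φ} := by
    refine ⟨fun p => ?_, ?_⟩
    · obtain ⟨φ, hφ, hp⟩ := 𝓜.exists_chart p.pt
      obtain ⟨Φ, hΦ⟩ := 𝓜.exists_isLevelChart hφ 1
      exact ⟨Φ, ⟨φ, hφ, hΦ⟩, hΦ.mem_source.2 hp⟩
    · rintro Φ ⟨φ, hφ, hΦ⟩ Ψ ⟨ψ, hψ, hΨ⟩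
      exact ⟨hΦ.isScSmooth_transition hφ hψ hΨ, hΨ.isScSmooth_transition hψ hφ hΦ⟩
  obtain ⟨𝓜₁, h⟩ := hA.exists_scManifold
  refine ⟨𝓜₁, fun φ hφ => ?_⟩
  obtain ⟨Φ, hΦ⟩ := 𝓜.exists_isLevelChart hφ 1
  exact ⟨Φ, h ⟨φ, hφ, hΦ⟩, hΦ⟩

lemma mem_range_bond_shift {x : X.layer 1} :
    x ∈ range (X.shift.bond (Nat.zero_le m)) ↔
      X.bond (Nat.zero_le 1) x ∈ range (X.bond (Nat.zero_le (m + 1))) := by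
  constructor
  · rintro ⟨y, rfl⟩
    exact ⟨y, (X.bond_bond (Nat.succ_le_succ (Nat.zero_le m)) (Nat.zero_le 1) y).symm⟩
  · rintro ⟨y, hy⟩
    refine ⟨y, X.bond_injective (Nat.zero_le 1) ?_⟩
    rw [← hy]
    exact X.bond_bond (Nat.succ_le_succ (Nat.zero_le m)) (Nat.zero_le 1) y

variable {𝓜}

lemma mem_level_shift {𝓜₁ : ScManifold X.shift (𝓜.Level 1)}
    (h : ∀ φ ∈ 𝓜.atlas, ∃ Φ ∈ 𝓜₁.atlas, 𝓜.IsLevelChart φ 1 Φ) (p : 𝓜.Level 1) :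
    p ∈ 𝓜₁.level m ↔ p.pt ∈ 𝓜.level (m + 1) := by
  obtain ⟨φ, hφ, hp⟩ := 𝓜.exists_chart p.pt
  obtain ⟨Φ, hΦ₁, hΦ⟩ := h φ hφ
  have hpΦ : p ∈ Φ.source := hΦ.mem_source.2 hp
  rw [𝓜₁.mem_level_iff hΦ₁ hpΦ, 𝓜.mem_level_iff hφ hp, ← hΦ.bond_apply p hpΦ]
  exact mem_range_bond_shift

end Shift

section Maps

variable {X : BanachScale.{u} ℕ} {M : Type v} [TopologicalSpace M] {𝓜 : ScManifold X M}
  {Y : BanachScale.{u} ℕ} {N : Type w} [TopologicalSpace N] {𝓢 : ScManifold Y N} {f : M → N}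

/-- A map with sc-smooth representatives in charts is sc-smooth. -/
lemma isScSmoothMap_of_charts (h : ∀ p : M, ∃ φ ∈ 𝓜.atlas, ∃ ψ ∈ 𝓢.atlas, p ∈ φ.source ∧
    f p ∈ ψ.source ∧ MapsTo f φ.source ψ.source ∧
      IsScSmooth X Y φ.target (ψ ∘ f ∘ φ.symm)) : 𝓜.IsScSmoothMap 𝓢 f := by
  refine ⟨fun m => ?_, h⟩
  have hl : ∀ p : 𝓜.Level m, f p.pt ∈ 𝓢.level m := by
    intro p
    obtain ⟨φ, hφ, ψ, hψ, hp, hfp, -, hs⟩ := h p.pt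
    rw [𝓢.mem_level_iff hψ hfp]
    have := hs.isScZero.mem_range (φ.map_source hp) ((𝓜.mem_level_iff hφ hp).1 p.mem)
    simpa only [Function.comp_apply, φ.left_inv hp] using this
  refine ⟨fun p => ⟨f p.pt, hl p⟩, continuous_iff_continuousAt.2 fun p => ?_, fun p => rfl⟩
  obtain ⟨φ, hφ, ψ, hψ, hp, hfp, hm, hs⟩ := h p.pt
  obtain ⟨Φ, hΦ⟩ := 𝓜.exists_isLevelChart hφ m
  obtain ⟨Ψ, hΨ⟩ := 𝓢.exists_isLevelChart hψ m
  have hpΦ : p ∈ Φ.source := hΦ.mem_source.2 hp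
  have key : ∀ q ∈ Φ.source, Y.lift m ((ψ ∘ f ∘ φ.symm) (X.bond (Nat.zero_le m) (Φ q))) =
      Ψ ⟨f q.pt, hl q⟩ := by
    intro q hq
    rw [hΨ.apply, hΦ.bond_apply q hq]
    simp only [Function.comp_apply]
    rw [φ.left_inv (hΦ.mem_source.1 hq)]
  -- On level `m` the map is continuous in the coordinates of the level charts; the inverse of `Ψ`
  -- then returns to the level of the target.
  have hc : ContinuousAt (fun q => Y.lift m ((ψ ∘ f ∘ φ.symm) (X.bond (Nat.zero_le m) (Φ q)))) p := by
    refine ContinuousAt.comp (g := fun x => Y.lift m ((ψ ∘ f ∘ φ.symm) (X.bond (Nat.zero_le m) x)))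
      ?_ (Φ.continuousAt hpΦ)
    exact (hs.isScZero.continuousOn_lift m).continuousAt
      ((X.isOpen_preimage_bond φ.open_target m).mem_nhds (hΦ.mem_target.1 (Φ.map_source hpΦ)))
  have hps : (⟨f p.pt, hl p⟩ : 𝓢.Level m) ∈ Ψ.source := hΨ.mem_source.2 hfp
  have hc2 : ContinuousAt (fun q => Ψ.symm (Y.lift m
      ((ψ ∘ f ∘ φ.symm) (X.bond (Nat.zero_le m) (Φ q))))) p := by
    refine ContinuousAt.comp (g := Ψ.symm) ?_ hc
    rw [key p hpΦ]
    exact Ψ.symm.continuousAt (Ψ.map_source hps)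
  refine hc2.congr ?_
  filter_upwards [Φ.open_source.mem_nhds hpΦ] with q hq
  rw [key q hq, Ψ.left_inv]
  exact hΨ.mem_source.2 (hm (hΦ.mem_source.1 hq))

end Maps

end ScManifold

/-! ### The model isomorphism between tangent and cotangent scales -/

namespace SymplecticForm

variable {X : BanachScale.{u} ℤ} (ω : SymplecticForm X)

/-- The isomorphism of scales `id × ι_ω : X^1 × X → X^1 × X^*`, on non-negative layers. -/
def tangentToCotangent : ScLinear X.nonneg.tangent ω.cotangentModel where
  map m := (ContinuousLinearMap.id ℝ (X.nonneg.layer (m + 1))).prodMap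
    (ω.iota (neg_add_cancel (m : ℤ)) : X.layer (m : ℤ) →L[ℝ] (X.layer (-(m : ℤ)) →L[ℝ] ℝ))
  bond_map m x := Prod.ext rfl
    (ω.dualBond_iota (Int.ofNat_le.2 (Nat.zero_le m))
      (show X.nonneg.layer (m + 1) × X.layer (m : ℤ) from x).2)

/-- The inverse of `id × ι_ω`. -/
def cotangentToTangent : ScLinear ω.cotangentModel X.nonneg.tangent where
  map m := (ContinuousLinearMap.id ℝ (X.nonneg.layer (m + 1))).prodMap
    ((ω.iota (neg_add_cancel (m : ℤ))).symm :
      (X.layer (-(m : ℤ)) →L[ℝ] ℝ) →L[ℝ] X.layer (m : ℤ))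
  bond_map m x := by
    refine Prod.ext rfl ?_
    have h := ω.dualBond_iota (Int.ofNat_le.2 (Nat.zero_le m)) ((ω.iota (neg_add_cancel (m : ℤ))).symm
      (show X.nonneg.layer (m + 1) × (X.layer (-(m : ℤ)) →L[ℝ] ℝ) from x).2)
    rw [ContinuousLinearEquiv.apply_symm_apply] at h
    exact ((ContinuousLinearEquiv.symm_apply_eq _).2 h).symm

end SymplecticForm

/-! ### The atlas of the cotangent bundle -/

namespace SymplecticScManifold

variable {X : BanachScale.{u} ℤ} {ω : SymplecticForm X} {M : Type v} [TopologicalSpace M]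
  (𝓜 : SymplecticScManifold ω M) {φ ψ : OpenPartialHomeomorph M (X.nonneg.layer 0)} {p : M}

lemma mem_atlas (hφ : φ ∈ 𝓜.symplecticAtlas) : φ ∈ 𝓜.atlas := 𝓜.isMaximal.prop.subset hφ

lemma exists_symplecticChart (p : M) : ∃ φ ∈ 𝓜.symplecticAtlas, p ∈ φ.source :=
  𝓜.isMaximal.prop.cover p

/-- The map `T^*φ`, extended by `0` in the second component. -/
def cotangentMap (φ : OpenPartialHomeomorph M (X.nonneg.layer 0)) (hφ : φ ∈ 𝓜.atlas)
    (q : 𝓜.Cotangent) : ω.cotangentModel.layer 0 :=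
  open Classical in
  ((X.nonneg.lift 1 (φ q.base.pt),
    if h : q.base.pt ∈ φ.source then q.covector.comp (𝓜.chartDeriv ⟨φ, hφ, h⟩ 0).inverse else 0) :
      X.nonneg.layer 1 × (X.nonneg.layer 0 →L[ℝ] ℝ))

lemma cotangentMap_apply (hφ : φ ∈ 𝓜.atlas) (q : 𝓜.Cotangent) (h : q.base.pt ∈ φ.source) :
    𝓜.cotangentMap φ hφ q = ((X.nonneg.lift 1 (φ q.base.pt),
      q.covector.comp (𝓜.chartDeriv ⟨φ, hφ, h⟩ 0).inverse) :
        X.nonneg.layer 1 × (X.nonneg.layer 0 →L[ℝ] ℝ)) := by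
  rw [cotangentMap, dif_pos h]

lemma isInvertible_chartDeriv_zero (φ : 𝓜.ChartAt p) (hp : p ∈ 𝓜.level 1) :
    (𝓜.chartDeriv φ 0).IsInvertible := 𝓜.isInvertible_chartDeriv φ hp

lemma bijOn_cotangentMap (hφ : φ ∈ 𝓜.atlas) : BijOn (𝓜.cotangentMap φ hφ)
    {q | q.base.pt ∈ φ.source} {z : X.nonneg.layer 1 × (X.nonneg.layer 0 →L[ℝ] ℝ) |
      X.nonneg.bond (Nat.zero_le 1) z.1 ∈ φ.target} := by
  have hb := 𝓜.bijOn_levelChart hφ 1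
  refine ⟨fun q hq => ?_, fun q hq r hr h => ?_, fun z hz => ?_⟩
  · exact hb.mapsTo hq
  · rw [𝓜.cotangentMap_apply hφ q hq, 𝓜.cotangentMap_apply hφ r hr] at h
    obtain ⟨h1, h2⟩ := Prod.ext_iff.1 h
    have h3 := hb.injOn hq hr h1
    obtain ⟨b, c⟩ := q
    obtain ⟨b', c'⟩ := r
    obtain rfl : b = b' := h3
    obtain ⟨e, he⟩ := 𝓜.isInvertible_chartDeriv_zero ⟨φ, hφ, hq⟩ b.mem
    simp only [← he, ContinuousLinearMap.inverse_equiv] at h2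
    have : c = c' := ContinuousLinearMap.ext fun x => by
      simpa using congrArg (fun L : X.nonneg.layer 0 →L[ℝ] ℝ => L (e x)) h2
    rw [this]
  · obtain ⟨b, hbs, hbz⟩ := hb.surjOn hz
    have hs : b.pt ∈ φ.source := hbs
    obtain ⟨e, he⟩ := 𝓜.isInvertible_chartDeriv_zero ⟨φ, hφ, hs⟩ b.mem
    let c : X.nonneg.layer 0 →L[ℝ] ℝ := (show X.nonneg.layer 1 × (X.nonneg.layer 0 →L[ℝ] ℝ) from z).2
    -- The preimage is the pullback of the coordinate covector by `D_p φ`.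
    refine ⟨⟨b, c.comp (𝓜.chartDeriv ⟨φ, hφ, hs⟩ 0)⟩, hs, ?_⟩
    rw [𝓜.cotangentMap_apply hφ _ hs]
    refine Prod.ext hbz (ContinuousLinearMap.ext fun x => ?_)
    simp only [← he, ContinuousLinearMap.inverse_equiv]
    change c (e (e.symm x)) = c x
    rw [e.apply_symm_apply]

/-- On symplectic charts the coordinate changes of `T^*M` are conjugate to those of `TM`. -/
lemma cotangentMap_transition (hφ : φ ∈ 𝓜.symplecticAtlas) (hψ : ψ ∈ 𝓜.symplecticAtlas)
    (q : 𝓜.Cotangent) (hqφ : q.base.pt ∈ φ.source) (hqψ : q.base.pt ∈ ψ.source) :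
    ω.tangentToCotangent.map 0 (scTangentMap X.nonneg X.nonneg (φ.symm.trans ψ).source
      (φ.symm.trans ψ) (ω.cotangentToTangent.map 0 (𝓜.cotangentMap φ (𝓜.mem_atlas hφ) q))) =
    𝓜.cotangentMap ψ (𝓜.mem_atlas hψ) q := by
  have hφ' := 𝓜.mem_atlas hφ
  have hψ' := 𝓜.mem_atlas hψ
  rw [𝓜.cotangentMap_apply _ q hqφ, 𝓜.cotangentMap_apply _ q hqψ]
  have hbond := 𝓜.bond_lift_one hφ' hqφ q.base.mem
  refine Prod.ext ?_ (ContinuousLinearMap.ext fun a => ?_)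
  · change X.nonneg.lift 1 ((φ.symm.trans ψ) (X.nonneg.bond (Nat.zero_le 1)
      (X.nonneg.lift 1 (φ q.base.pt)))) = X.nonneg.lift 1 (ψ q.base.pt)
    rw [hbond, symm_trans_apply hqφ]
  · obtain ⟨e, he⟩ := 𝓜.isInvertible_chartDeriv_zero ⟨φ, hφ', hqφ⟩ q.base.mem
    obtain ⟨e', he'⟩ := 𝓜.isInvertible_chartDeriv_zero ⟨ψ, hψ', hqψ⟩ q.base.mem
    set x := X.nonneg.lift 1 (φ q.base.pt) with hx
    let α : X.nonneg.layer 0 →L[ℝ] ℝ := q.covector.comp (𝓜.chartDeriv ⟨φ, hφ', hqφ⟩ 0).inverse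
    -- `w` represents the coordinate covector `α` through `ω_0`.
    let w : X.nonneg.layer 0 := (ω.iota (neg_add_cancel ((0 : ℕ) : ℤ))).symm α
    have hw : ω.iota (neg_add_cancel ((0 : ℕ) : ℤ)) w = α := ContinuousLinearEquiv.apply_symm_apply _ _
    -- It suffices to test on the `ψ`-coordinates of tangent vectors `v`, which are the images of
    -- their `φ`-coordinates under the derivative of the transition map.
    obtain ⟨v, rfl⟩ := e'.surjective a
    have hv : e' v = scDeriv X.nonneg X.nonneg (φ.symm.trans ψ).source (φ.symm.trans ψ) x (e v) := by
      have := 𝓜.bond_chartDeriv ⟨φ, hφ', hqφ⟩ ⟨ψ, hψ', hqψ⟩ v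
      rw [X.nonneg.bond_self, X.nonneg.bond_self, ← he, ← he'] at this
      exact this
    -- Invariance of `ω_0` says that the derivative of the transition map, applied to `w`,
    -- represents the covector in the chart `ψ`.
    have hsymp := (𝓜.isMaximal.prop.compatible φ hφ ψ hψ).symplectic x
      (by rw [hbond]; exact apply_mem_symm_trans_source hqφ hqψ) (e v) w
    have h1 : α (e v) = q.covector v := by
      simp only [α, ← he, ContinuousLinearMap.inverse_equiv]
      change q.covector (e.symm (e v)) = _
      rw [e.symm_apply_apply]
    rw [← hv] at hsymp
    have h2 : ω.form (s := ((0 : ℕ) : ℤ)) (t := ((0 : ℕ) : ℤ)) (by simp) (e v) w = α (e v) :=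
      congrArg (fun L : X.nonneg.layer 0 →L[ℝ] ℝ => L (e v)) hw
    have h3 : (q.covector.comp (𝓜.chartDeriv ⟨ψ, hψ', hqψ⟩ 0).inverse) (e' v) = q.covector v := by
      rw [← he', ContinuousLinearMap.inverse_equiv]
      change q.covector (e'.symm (e' v)) = _
      rw [e'.symm_apply_apply]
    exact hsymp.trans ((h2.trans h1).trans h3.symm)

/-- The coordinate change of `T^*M` for two symplectic charts. -/
def cotangentTransition (φ ψ : OpenPartialHomeomorph M (X.nonneg.layer 0)) :
    ω.cotangentModel.layer 0 → ω.cotangentModel.layer 0 :=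
  ω.tangentToCotangent.map 0 ∘ scTangentMap X.nonneg X.nonneg (φ.symm.trans ψ).source
    (φ.symm.trans ψ) ∘ ω.cotangentToTangent.map 0

lemma isOpen_cotangentTarget (ω : SymplecticForm X) {U : Set (X.nonneg.layer 0)} (hU : IsOpen U) :
    IsOpen (X := ω.cotangentModel.layer 0) {z : X.nonneg.layer 1 × (X.nonneg.layer 0 →L[ℝ] ℝ) |
      X.nonneg.bond (Nat.zero_le 1) z.1 ∈ U} :=
  (X.nonneg.isOpen_preimage_bond hU 1).preimage
    (continuous_fst (X := X.nonneg.layer 1) (Y := X.nonneg.layer 0 →L[ℝ] ℝ))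

/-- Only the tangent map and linear isomorphisms of scales enter; no inverse or adjoint of a
derivative has to be differentiated. -/
lemma isScSmooth_cotangentTransition (hφ : φ ∈ 𝓜.symplecticAtlas) (hψ : ψ ∈ 𝓜.symplecticAtlas) :
    IsScSmooth ω.cotangentModel ω.cotangentModel
      {z : X.nonneg.layer 1 × (X.nonneg.layer 0 →L[ℝ] ℝ) |
        X.nonneg.bond (Nat.zero_le 1) z.1 ∈ (φ.symm.trans ψ).source}
      (cotangentTransition (ω := ω) φ ψ) := by
  have ho := (φ.symm.trans ψ).open_source
  have h1 := (𝓜.isScSmooth_transition (𝓜.mem_atlas hφ) (𝓜.mem_atlas hψ)).tangentMap ho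
  have h2 := h1.comp (ω.cotangentToTangent.isScSmooth) (isOpen_cotangentTarget ω ho)
    (isOpen_tangentSet ho) fun z hz => hz
  exact (ω.tangentToCotangent.isScSmooth (U := univ)).comp h2 (isOpen_cotangentTarget ω ho)
    isOpen_univ fun _ _ => mem_univ _

lemma nonempty_cotangent (h : Nonempty M) : Nonempty 𝓜.Cotangent :=
  let ⟨p⟩ := 𝓜.nonempty_level h 1
  ⟨⟨p, 0⟩⟩

/-- The topology of `T^*M` generated by the charts `T^*φ`. -/
@[reducible]
def cotangentTopology : TopologicalSpace 𝓜.Cotangent :=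
  TopologicalSpace.generateFrom {s | ∃ φ : 𝓜.symplecticAtlas,
    ∃ W : Set (ω.cotangentModel.layer 0), IsOpen W ∧
      s = {q | q.base.pt ∈ φ.1.source ∧ 𝓜.cotangentMap φ.1 (𝓜.mem_atlas φ.2) q ∈ W}}

/-- `Φ` is the chart with underlying map `T^*φ`. -/
structure IsChartOfCotangentMap [TopologicalSpace 𝓜.Cotangent]
    (φ : OpenPartialHomeomorph M (X.nonneg.layer 0)) (hφ : φ ∈ 𝓜.atlas)
    (Φ : OpenPartialHomeomorph 𝓜.Cotangent (ω.cotangentModel.layer 0)) : Prop where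
  source : Φ.source = {q | q.base.pt ∈ φ.source}
  target : Φ.target = {z : X.nonneg.layer 1 × (X.nonneg.layer 0 →L[ℝ] ℝ) |
    X.nonneg.bond (Nat.zero_le 1) z.1 ∈ φ.target}
  apply : ∀ q, Φ q = 𝓜.cotangentMap φ hφ q

section Charts

variable {𝓜} [TopologicalSpace 𝓜.Cotangent]

lemma IsChartOfCotangentMap.mem_source {hφ : φ ∈ 𝓜.atlas}
    {Φ : OpenPartialHomeomorph 𝓜.Cotangent (ω.cotangentModel.layer 0)}
    (h : 𝓜.IsChartOfCotangentMap φ hφ Φ) {q : 𝓜.Cotangent} :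
    q ∈ Φ.source ↔ q.base.pt ∈ φ.source := by
  rw [h.source]; rfl

lemma IsChartOfCotangentMap.isCotangentChart {hφ : φ ∈ 𝓜.atlas}
    {Φ : OpenPartialHomeomorph 𝓜.Cotangent (ω.cotangentModel.layer 0)}
    (h : 𝓜.IsChartOfCotangentMap φ hφ Φ) : 𝓜.IsCotangentChart φ hφ Φ where
  source := h.source
  target := h.target
  fst q hq := (congrArg (fun z : X.nonneg.layer 1 × (X.nonneg.layer 0 →L[ℝ] ℝ) =>
    X.nonneg.bond (Nat.zero_le 1) z.1) (h.apply q)).trans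
      (𝓜.bond_lift_one hφ (h.mem_source.1 hq) q.base.mem)
  snd q hq := congrArg (fun z : X.nonneg.layer 1 × (X.nonneg.layer 0 →L[ℝ] ℝ) => z.2)
    ((h.apply q).trans (𝓜.cotangentMap_apply hφ q hq))

lemma IsChartOfCotangentMap.fst_apply {hφ : φ ∈ 𝓜.atlas}
    {Φ : OpenPartialHomeomorph 𝓜.Cotangent (ω.cotangentModel.layer 0)}
    (h : 𝓜.IsChartOfCotangentMap φ hφ Φ) (q : 𝓜.Cotangent) :
    (ScLinear.fst X.nonneg.shift ω.dual.nonneg).map 0 (Φ q) = X.nonneg.lift 1 (φ q.base.pt) :=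
  congrArg (fun z : X.nonneg.layer 1 × (X.nonneg.layer 0 →L[ℝ] ℝ) => z.1) (h.apply q)

lemma IsChartOfCotangentMap.isScSmooth_transition (hφ : φ ∈ 𝓜.symplecticAtlas)
    (hψ : ψ ∈ 𝓜.symplecticAtlas)
    {Φ Ψ : OpenPartialHomeomorph 𝓜.Cotangent (ω.cotangentModel.layer 0)}
    (hΦ : 𝓜.IsChartOfCotangentMap φ (𝓜.mem_atlas hφ) Φ)
    (hΨ : 𝓜.IsChartOfCotangentMap ψ (𝓜.mem_atlas hψ) Ψ) :
    IsScSmooth ω.cotangentModel ω.cotangentModel (Φ.symm.trans Ψ).source (Φ.symm.trans Ψ) := by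
  have key : ∀ z ∈ (Φ.symm.trans Ψ).source, ∃ q : 𝓜.Cotangent, q.base.pt ∈ φ.source ∧
      q.base.pt ∈ ψ.source ∧ Φ.symm z = q ∧ 𝓜.cotangentMap φ (𝓜.mem_atlas hφ) q = z := by
    intro z hz
    rw [mem_symm_trans_source] at hz
    refine ⟨Φ.symm z, hΦ.mem_source.1 (Φ.map_target hz.1), hΨ.mem_source.1 hz.2, rfl, ?_⟩
    rw [← hΦ.apply, Φ.right_inv hz.1]
  refine ((𝓜.isScSmooth_cotangentTransition hφ hψ).mono fun z hz => ?_).congr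
    (Φ.symm.trans Ψ).open_source fun z hz => ?_
  · obtain ⟨q, hq, hq', -, rfl⟩ := key z hz
    change X.nonneg.bond (Nat.zero_le 1) (X.nonneg.lift 1 (φ q.base.pt)) ∈
      (φ.symm.trans ψ).source
    rw [𝓜.bond_lift_one (𝓜.mem_atlas hφ) hq q.base.mem]
    exact apply_mem_symm_trans_source hq hq'
  · obtain ⟨q, hq, hq', h1, h2⟩ := key z hz
    rw [OpenPartialHomeomorph.coe_trans, Function.comp_apply, h1, hΨ.apply, ← h2]
    exact 𝓜.cotangentMap_transition hφ hψ q hq hq'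

/-- In the charts induced by one symplectic chart this is the projection to the first factor. -/
lemma continuous_base (h : ∀ (φ : OpenPartialHomeomorph M (X.nonneg.layer 0))
    (hφ : φ ∈ 𝓜.symplecticAtlas), ∃ Φ, 𝓜.IsChartOfCotangentMap φ (𝓜.mem_atlas hφ) Φ) :
    Continuous fun q : 𝓜.Cotangent => q.base := by
  refine continuous_iff_continuousAt.2 fun q => ?_
  obtain ⟨φ, hφ, hq⟩ := 𝓜.exists_symplecticChart q.base.pt
  obtain ⟨Φ, hΦ⟩ := h φ hφ
  obtain ⟨Ψ, hΨ⟩ := 𝓜.exists_isLevelChart (𝓜.mem_atlas hφ) 1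
  have hqΦ := hΦ.mem_source.2 hq
  have key : ∀ r : 𝓜.Cotangent,
      (ScLinear.fst X.nonneg.shift ω.dual.nonneg).map 0 (Φ r) = Ψ r.base := fun r =>
    (hΦ.fst_apply r).trans (hΨ.apply r.base).symm
  have hc : ContinuousAt (fun r => (ScLinear.fst X.nonneg.shift ω.dual.nonneg).map 0 (Φ r)) q :=
    ((ScLinear.fst X.nonneg.shift ω.dual.nonneg).map 0).continuous.continuousAt.comp
      (Φ.continuousAt hqΦ)
  have hc1 : ContinuousAt (fun r : 𝓜.Cotangent => Ψ r.base) q :=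
    hc.congr (Eventually.of_forall key)
  have hc2 : ContinuousAt (fun r : 𝓜.Cotangent => Ψ.symm (Ψ r.base)) q :=
    ContinuousAt.comp (g := Ψ.symm)
      (Ψ.symm.continuousAt (Ψ.map_source (hΨ.mem_source.2 hq))) hc1
  refine hc2.congr ?_
  filter_upwards [Φ.open_source.mem_nhds hqΦ] with r hr
  exact Ψ.left_inv (hΨ.mem_source.2 (hΦ.mem_source.1 hr))

/-- Points over different base points are separated in the base. Points of one fibre lie in a common
chart, since the domain of `T^*φ` contains whole fibres. -/
lemma t2Space_cotangent (h : ∀ (φ : OpenPartialHomeomorph M (X.nonneg.layer 0))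
    (hφ : φ ∈ 𝓜.symplecticAtlas), ∃ Φ, 𝓜.IsChartOfCotangentMap φ (𝓜.mem_atlas hφ) Φ) :
    T2Space 𝓜.Cotangent := by
  refine ⟨fun q r hqr => ?_⟩
  by_cases hb : q.base = r.base
  · obtain ⟨φ, hφ, hq⟩ := 𝓜.exists_symplecticChart q.base.pt
    obtain ⟨Φ, hΦ⟩ := h φ hφ
    have hqΦ := hΦ.mem_source.2 hq
    have hrΦ := hΦ.mem_source.2 (hb ▸ hq)
    obtain ⟨U, V, hU, hV, hqU, hrV, hUV⟩ := t2_separation (fun h => hqr (Φ.injOn hqΦ hrΦ h))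
    exact ⟨_, _, Φ.isOpen_inter_preimage hU, Φ.isOpen_inter_preimage hV, ⟨hqΦ, hqU⟩, ⟨hrΦ, hrV⟩,
      (hUV.preimage Φ).mono inter_subset_right inter_subset_right⟩
  · exact separated_by_continuous (continuous_base h) hb

/-- The cotangent bundle as an `sc^∞`-manifold, for a topology in which the maps `T^*φ` of symplectic
charts are charts. -/
lemma exists_scManifold_cotangent (h : ∀ (φ : OpenPartialHomeomorph M (X.nonneg.layer 0))
    (hφ : φ ∈ 𝓜.symplecticAtlas), ∃ Φ, 𝓜.IsChartOfCotangentMap φ (𝓜.mem_atlas hφ) Φ) :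
    ∃ 𝓣 : ScManifold ω.cotangentModel 𝓜.Cotangent,
      ∀ (φ : OpenPartialHomeomorph M (X.nonneg.layer 0)) (hφ : φ ∈ 𝓜.symplecticAtlas),
        ∃ Φ ∈ 𝓣.atlas, 𝓜.IsChartOfCotangentMap φ (𝓜.mem_atlas hφ) Φ := by
  have := t2Space_cotangent h
  have hA : IsScAtlas ω.cotangentModel 𝓜.Cotangent
      {Φ | ∃ φ, ∃ hφ : φ ∈ 𝓜.symplecticAtlas,
        𝓜.IsChartOfCotangentMap φ (𝓜.mem_atlas hφ) Φ} := by
    refine ⟨fun q => ?_, ?_⟩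
    · obtain ⟨φ, hφ, hq⟩ := 𝓜.exists_symplecticChart q.base.pt
      obtain ⟨Φ, hΦ⟩ := h φ hφ
      exact ⟨Φ, ⟨φ, hφ, hΦ⟩, hΦ.mem_source.2 hq⟩
    · rintro Φ ⟨φ, hφ, hΦ⟩ Ψ ⟨ψ, hψ, hΨ⟩
      exact ⟨hΦ.isScSmooth_transition hφ hψ hΨ, hΨ.isScSmooth_transition hψ hφ hΦ⟩
  obtain ⟨𝓣, h𝓣⟩ := hA.exists_scManifold
  refine ⟨𝓣, fun φ hφ => ?_⟩
  obtain ⟨Φ, hΦ⟩ := h φ hφ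
  exact ⟨Φ, h𝓣 ⟨φ, hφ, hΦ⟩, hΦ⟩

end Charts

attribute [local instance] cotangentTopology

lemma exists_isChartOfCotangentMap (hφ : φ ∈ 𝓜.symplecticAtlas) :
    ∃ Φ, 𝓜.IsChartOfCotangentMap φ (𝓜.mem_atlas hφ) Φ := by
  have hne : Nonempty 𝓜.Cotangent := 𝓜.nonempty_cotangent ⟨φ.symm 0⟩
  let e : 𝓜.symplecticAtlas → PartialEquiv 𝓜.Cotangent (ω.cotangentModel.layer 0) := fun φ =>
    (𝓜.bijOn_cotangentMap (𝓜.mem_atlas φ.2)).toPartialEquiv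
  have hrep : ∀ (i : 𝓜.symplecticAtlas) (z : ω.cotangentModel.layer 0), z ∈ (e i).target →
      ((e i).symm z).base.pt ∈ i.1.source ∧
      𝓜.cotangentMap i.1 (𝓜.mem_atlas i.2) ((e i).symm z) = z ∧
      ((e i).symm z).base.pt = i.1.symm (X.nonneg.bond (Nat.zero_le 1)
        (show X.nonneg.layer 1 × (X.nonneg.layer 0 →L[ℝ] ℝ) from z).1) := by
    intro i z hz
    have h1 : ((e i).symm z).base.pt ∈ i.1.source := (e i).map_target hz
    have h2 : 𝓜.cotangentMap i.1 (𝓜.mem_atlas i.2) ((e i).symm z) = z := (e i).right_inv hz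
    refine ⟨h1, h2, ?_⟩
    conv_rhs => rw [← h2]
    change _ = i.1.symm (X.nonneg.bond (Nat.zero_le 1) (X.nonneg.lift 1 (i.1 ((e i).symm z).base.pt)))
    rw [𝓜.bond_lift_one (𝓜.mem_atlas i.2) h1 ((e i).symm z).base.mem, i.1.left_inv h1]
  have hsrc : ∀ i j, ((e i).symm.trans (e j)).source =
      {z : X.nonneg.layer 1 × (X.nonneg.layer 0 →L[ℝ] ℝ) |
        X.nonneg.bond (Nat.zero_le 1) z.1 ∈ (i.1.symm.trans j.1).source} := by
    intro i j
    ext z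
    rw [PartialEquiv.trans_source]
    change z ∈ (e i).target ∧ ((e i).symm z).base.pt ∈ j.1.source ↔
      X.nonneg.bond (Nat.zero_le 1)
        (show X.nonneg.layer 1 × (X.nonneg.layer 0 →L[ℝ] ℝ) from z).1 ∈ (i.1.symm.trans j.1).source
    rw [mem_symm_trans_source]
    exact and_congr_right fun h => by rw [(hrep i z h).2.2]
  obtain ⟨Φ, hΦ⟩ := exists_openPartialHomeomorph e rfl
    (fun i j => by
      rw [hsrc]
      exact isOpen_cotangentTarget ω (i.1.symm.trans j.1).open_source)
    (fun i j => by
      refine ((𝓜.isScSmooth_cotangentTransition i.2 j.2).isScZero.continuousOn.mono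
        (hsrc i j).le).congr fun z hz => ?_
      rw [PartialEquiv.trans_source] at hz
      obtain ⟨h1, h2, -⟩ := hrep i z hz.1
      -- The transition between the partial bijections is the coordinate change
      -- `cotangentTransition`, already known to be sc^0.
      have h3 := 𝓜.cotangentMap_transition i.2 j.2 _ h1 hz.2
      rw [h2] at h3
      exact h3.symm) ⟨φ, hφ⟩
  exact ⟨Φ, congrArg PartialEquiv.source hΦ, congrArg PartialEquiv.target hΦ, fun q =>
    congrFun (congrArg (fun e : PartialEquiv 𝓜.Cotangent (ω.cotangentModel.layer 0) =>
      (e : 𝓜.Cotangent → ω.cotangentModel.layer 0)) hΦ) q⟩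

end SymplecticScManifold

/-! ### The extended tangent scale and its dual -/

lemma ContinuousLinearMap.IsInvertible.precomp {E F : Type*} [AddCommGroup E] [Module ℝ E]
    [TopologicalSpace E] [IsTopologicalAddGroup E] [ContinuousSMul ℝ E] [AddCommGroup F]
    [Module ℝ F] [TopologicalSpace F] [IsTopologicalAddGroup F] [ContinuousSMul ℝ F]
    {A : E →L[ℝ] F} (hA : A.IsInvertible) :
    (ContinuousLinearMap.precomp ℝ A : (F →L[ℝ] ℝ) →L[ℝ] (E →L[ℝ] ℝ)).IsInvertible := by
  obtain ⟨e, rfl⟩ := hA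
  refine ⟨ContinuousLinearEquiv.equivOfInverse (ContinuousLinearMap.precomp ℝ (e : E →L[ℝ] F))
    (ContinuousLinearMap.precomp ℝ (e.symm : F →L[ℝ] E)) (fun a => ?_) fun a => ?_, rfl⟩ <;>
  · ext x
    simp

/-- A system of topological vector spaces isomorphic to a Banach scale is a Banachable scale. -/
lemma TVSSystem.isBanachableScale_of_equiv {ι : Type} [Preorder ι] {Z : TVSSystem.{max u v} ι}
    (Y : BanachScale.{u} ι) (e : ∀ s, Z.layer s ≃L[ℝ] Y.layer s)
    (he : ∀ {s r : ι} (h : r ≤ s) (x : Z.layer s), e r (Z.bond h x) = Y.bond h (e s x)) :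
    Z.IsBanachableScale where
  -- The Banach space has to live in the universe of the layers of `Z`.
  banachable s := ⟨ULift.{v} (Y.layer s), inferInstance, inferInstance, inferInstance,
    ⟨(e s).trans ContinuousLinearEquiv.ulift.symm⟩⟩
  bond_self s x := (e s).injective (by rw [he, Y.bond_self])
  bond_bond hr hq x := (e _).injective (by rw [he, he, he, Y.bond_bond])
  bond_injective h x y hxy := (e _).injective (Y.bond_injective h (by rw [← he, ← he, hxy]))
  bond_compact {s r} h := by
    obtain ⟨K, hK, hK'⟩ := Y.bond_compact h
    refine ⟨(e r).symm '' K, hK.image (e r).symm.continuous, ?_⟩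
    have h1 := (e s).continuous.tendsto 0
    rw [map_zero] at h1
    filter_upwards [h1 hK'] with a ha
    exact ⟨_, ha, by rw [← he, ContinuousLinearEquiv.symm_apply_apply]⟩
  limit_dense s := by
    have h1 := (e s).symm.surjective.denseRange.dense_image (e s).symm.continuous (Y.limit_dense s)
    refine h1.mono ?_
    rintro _ ⟨_, ⟨x, hx, rfl⟩, rfl⟩
    refine ⟨fun t => (e t).symm (x t), fun {t r} h => (e r).injective ?_, rfl⟩
    rw [he, ContinuousLinearEquiv.apply_symm_apply, ContinuousLinearEquiv.apply_symm_apply, hx h]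

namespace SymplecticScManifold

variable {X : BanachScale.{u} ℤ} {ω : SymplecticForm X} {M : Type v} [TopologicalSpace M]
  (𝓜 : SymplecticScManifold ω M) {p : M}

/-- Index `s` only requires `p` to lie in level `|s| + 1`: for negative `s` the map consists of the
inverse of `ι_ω` and the adjoint of an inverse. -/
lemma isInvertible_extDeriv (φ : 𝓜.SymplecticChartAt p) {s : ℤ} {m : ℕ}
    (hp : p ∈ 𝓜.level (m + 1)) (hs : s.natAbs ≤ m) : (𝓜.extDeriv φ s).IsInvertible := by
  have h1 : p ∈ 𝓜.level (s.natAbs + 1) := 𝓜.level_anti (Nat.succ_le_succ hs) hp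
  cases s with
  | ofNat k => exact 𝓜.isInvertible_chartDeriv φ.1 h1
  | negSucc k =>
    have h2 : (𝓜.chartDeriv φ.1 (k + 1)).IsInvertible := 𝓜.isInvertible_chartDeriv φ.1 h1
    have h3 : ((𝓜.chartDeriv φ.1 (k + 1)).inverse).IsInvertible := by
      obtain ⟨e, he⟩ := h2
      rw [← he, ContinuousLinearMap.inverse_equiv]
      exact ⟨e.symm, rfl⟩
    exact ContinuousLinearMap.IsInvertible.comp ⟨_, rfl⟩ h3.precomp

/-- The extended derivative of a symplectic chart as an isomorphism. -/
def extDerivEquiv (φ : 𝓜.SymplecticChartAt p) {s : ℤ} {m : ℕ}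
    (hp : p ∈ 𝓜.level (m + 1)) (hs : s.natAbs ≤ m) : 𝓜.ExtLayer p s ≃L[ℝ] X.layer s :=
  (𝓜.isInvertible_extDeriv φ hp hs).choose

lemma coe_extDerivEquiv (φ : 𝓜.SymplecticChartAt p) {s : ℤ} {m : ℕ}
    (hp : p ∈ 𝓜.level (m + 1)) (hs : s.natAbs ≤ m) :
    (𝓜.extDerivEquiv φ hp hs : 𝓜.ExtLayer p s →L[ℝ] X.layer s) = 𝓜.extDeriv φ s :=
  (𝓜.isInvertible_extDeriv φ hp hs).choose_spec

/-- Here the regularity of `p` enters: the `inverse` in the definition of the bonding maps is a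
genuine inverse only where the extended derivative is invertible. The bounds `m` and `k` are
independent because they may vary with the index. -/
lemma extTangent_bond (φ : 𝓜.SymplecticChartAt p) {s r : ℤ} {m k : ℕ} (h : r ≤ s)
    (hp : p ∈ 𝓜.level (m + 1)) (hs : s.natAbs ≤ m) (hp' : p ∈ 𝓜.level (k + 1))
    (hr : r.natAbs ≤ k) (x : 𝓜.ExtLayer p s) :
    (𝓜.extTangent φ).bond h x = (𝓜.extDerivEquiv φ hp' hr).symm
      (X.bond h (𝓜.extDerivEquiv φ hp hs x)) := by
  change (𝓜.extDeriv φ r).inverse (X.bond h (𝓜.extDeriv φ s x)) = _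
  rw [← 𝓜.coe_extDerivEquiv φ hp hs, ← 𝓜.coe_extDerivEquiv φ hp' hr,
    ContinuousLinearMap.inverse_equiv]
  rfl

/-- The isomorphism `(T_p M)_{-s}^* ≃ X_{-s}^*` adjoint to the extended derivative of a chart. -/
def extDualEquiv (φ : 𝓜.SymplecticChartAt p) {s : ℤ} {m : ℕ}
    (hp : p ∈ 𝓜.level (m + 1)) (hs : s.natAbs ≤ m) :
    (𝓜.ExtLayer p (-s) →L[ℝ] ℝ) ≃L[ℝ] (X.layer (-s) →L[ℝ] ℝ) :=
  ContinuousLinearEquiv.equivOfInverse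
    (ContinuousLinearMap.precomp ℝ ((𝓜.extDerivEquiv φ hp (s := -s)
      (by rwa [Int.natAbs_neg])).symm : X.layer (-s) →L[ℝ] 𝓜.ExtLayer p (-s)))
    (ContinuousLinearMap.precomp ℝ (𝓜.extDerivEquiv φ hp (s := -s)
      (by rwa [Int.natAbs_neg]) : 𝓜.ExtLayer p (-s) →L[ℝ] X.layer (-s)))
    (fun a => ContinuousLinearMap.ext fun x => congrArg a
      (ContinuousLinearEquiv.symm_apply_apply _ x))
    (fun a => ContinuousLinearMap.ext fun x => congrArg a
      (ContinuousLinearEquiv.apply_symm_apply _ x))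

/-- The bonding maps of the tangent scale are those of `X` conjugated by the extended `D_p φ`; this
is the adjoint of that relation. -/
lemma extDualEquiv_bond (φ : 𝓜.SymplecticChartAt p) {s r : ℤ} {m k : ℕ} (h : r ≤ s)
    (hp : p ∈ 𝓜.level (m + 1)) (hs : s.natAbs ≤ m) (hp' : p ∈ 𝓜.level (k + 1))
    (hr : r.natAbs ≤ k) (β : 𝓜.ExtLayer p (-s) →L[ℝ] ℝ) :
    𝓜.extDualEquiv φ hp' hr ((𝓜.extTangent φ).dual.bond h β) =
      ω.dual.bond h (𝓜.extDualEquiv φ hp hs β) := by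
  refine ContinuousLinearMap.ext fun x => ?_
  exact (congrArg β (𝓜.extTangent_bond φ (neg_le_neg h) hp' (by rwa [Int.natAbs_neg]) hp
    (by rwa [Int.natAbs_neg]) _)).trans
    (congrArg (fun y => β ((𝓜.extDerivEquiv φ hp (s := -s) (by rwa [Int.natAbs_neg])).symm
      (X.bond (neg_le_neg h) y))) (ContinuousLinearEquiv.apply_symm_apply _ x))

/-- The adjoint bonding map `(T_p M)_{-m}^* → (T_p M)_0^*`, read off in a chart. -/
lemma toCovector_apply (φ : 𝓜.SymplecticChartAt p) {m : ℕ} (hp : p ∈ 𝓜.level (m + 1))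
    (β : 𝓜.ExtLayer p (-(m : ℤ)) →L[ℝ] ℝ) (v : 𝓜.TangentSpace p 0) :
    𝓜.toCovector φ m β v = 𝓜.extDualEquiv φ hp (Int.natAbs_natCast m).le β
      (X.bond (s := (0 : ℤ)) (r := -(m : ℤ)) (by simp) (𝓜.chartDeriv φ.1 0 v)) := by
  have h1 : 𝓜.extDerivEquiv φ hp (s := 0) (by simp) v = 𝓜.chartDeriv φ.1 0 v :=
    congrArg (fun L : 𝓜.ExtLayer p 0 →L[ℝ] X.layer 0 => L v)
      (𝓜.coe_extDerivEquiv φ hp (s := 0) (by simp))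
  exact congrArg β ((𝓜.extTangent_bond φ (s := 0) (r := -(m : ℤ)) (by simp) hp (by simp) hp
    (by simp) v).trans (congrArg (fun y => (𝓜.extDerivEquiv φ hp (s := -(m : ℤ)) (by simp)).symm
      (X.bond (s := (0 : ℤ)) (r := -(m : ℤ)) (by simp) y)) h1))

/-- In a chart this is functoriality of the bonding maps `X_0 → X_{-l} → X_{-k}`. -/
lemma toCovector_bond (φ : 𝓜.SymplecticChartAt p) {k l : ℕ} (h : (l : ℤ) ≤ (k : ℤ))
    (hp : p ∈ 𝓜.level (k + 1)) (β : (𝓜.extTangent φ).dual.layer (k : ℤ)) :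
    𝓜.toCovector φ l ((𝓜.extTangent φ).dual.bond h β) = 𝓜.toCovector φ k β := by
  have hp' : p ∈ 𝓜.level (l + 1) := 𝓜.level_anti (Nat.succ_le_succ (Int.ofNat_le.1 h)) hp
  refine ContinuousLinearMap.ext fun v => ?_
  refine (𝓜.toCovector_apply φ hp' _ v).trans (Eq.trans ?_ (𝓜.toCovector_apply φ hp β v).symm)
  refine (congrArg (fun L : X.layer (-(l : ℤ)) →L[ℝ] ℝ => L _) (𝓜.extDualEquiv_bond φ h hp
    (Int.natAbs_natCast k).le hp' (Int.natAbs_natCast l).le β)).trans ?_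
  exact congrArg (𝓜.extDualEquiv φ hp (Int.natAbs_natCast k).le β) (X.bond_bond _ _ _)

lemma isBanachableScale_extTangent_dual {m : ℕ∞} (φ : 𝓜.SymplecticChartAt p)
    (hp : ∀ k : ℕ, (k : ℕ∞) ≤ m → p ∈ 𝓜.level (k + 1)) :
    ((𝓜.extTangent φ).dual.restrict
      {s : ℤ | 0 ≤ s ∧ ((s.toNat : ℕ) : ℕ∞) ≤ m}).IsBanachableScale := by
  let S : Set ℤ := {s : ℤ | 0 ≤ s ∧ ((s.toNat : ℕ) : ℕ∞) ≤ m}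
  -- Each index gets its own finite level, so that `m = ⊤` needs no separate treatment.
  have hS : ∀ s : S, p ∈ 𝓜.level (s.1.toNat + 1) ∧ s.1.natAbs ≤ s.1.toNat := fun s =>
    ⟨hp _ s.2.2, by have := s.2.1; omega⟩
  exact TVSSystem.isBanachableScale_of_equiv (Z := (𝓜.extTangent φ).dual.restrict S)
    (ω.dual.reindex (fun s : S => s.1) (fun _ _ h => h) (fun _ _ h => h))
    (fun s => 𝓜.extDualEquiv φ (hS s).1 (hS s).2)
    (fun {s r} h x => 𝓜.extDualEquiv_bond φ h (hS s).1 (hS s).2 (hS r).1 (hS r).2 x)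

/-- A covector in a chart: it comes from `(T_p M)_{-m}^*` if its representative does. -/
lemma cotangentMap_toCovector (q : 𝓜.Cotangent) (φ : 𝓜.SymplecticChartAt q.base.pt) {m : ℕ}
    (hp : q.base.pt ∈ 𝓜.level (m + 1)) (β : 𝓜.ExtLayer q.base.pt (-(m : ℤ)) →L[ℝ] ℝ) :
    q.covector = 𝓜.toCovector φ m β ↔
      (show X.nonneg.layer 1 × (X.nonneg.layer 0 →L[ℝ] ℝ) from
        𝓜.cotangentMap φ.1.1 φ.1.2.1 q).2 =
      ω.dual.nonneg.bond (Nat.zero_le m) (𝓜.extDualEquiv φ hp (Int.natAbs_natCast m).le β) := by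
  obtain ⟨e, he⟩ := 𝓜.isInvertible_chartDeriv_zero φ.1 q.base.mem
  rw [𝓜.cotangentMap_apply φ.1.2.1 q φ.1.2.2]
  have he' : ∀ v, 𝓜.chartDeriv φ.1 0 v = e v := fun v => by rw [← he]; rfl
  have hc : ∀ x, (q.covector.comp (𝓜.chartDeriv ⟨φ.1.1, φ.1.2.1, φ.1.2.2⟩ 0).inverse) x =
      q.covector (e.symm x) := fun x => by
    have : 𝓜.chartDeriv ⟨φ.1.1, φ.1.2.1, φ.1.2.2⟩ 0 = e := he.symm
    rw [this, ContinuousLinearMap.inverse_equiv]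
    rfl
  constructor
  · refine fun h => ContinuousLinearMap.ext fun x => (hc x).trans ?_
    rw [h, 𝓜.toCovector_apply φ hp, he', e.apply_symm_apply]
    rfl
  · refine fun h => ContinuousLinearMap.ext fun v => ?_
    have h1 := congrArg (fun L : X.nonneg.layer 0 →L[ℝ] ℝ => L (e v)) h
    have h2 := (hc (e v)).symm.trans h1
    rw [e.symm_apply_apply] at h2
    rw [h2, 𝓜.toCovector_apply φ hp, he']
    rfl

end SymplecticScManifold

/-! ### Embeddings and submersions recognised in charts -/

lemma OpenPartialHomeomorph.isEmbedding_of_comp {A B H : Type*} [TopologicalSpace A]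
    [TopologicalSpace B] [TopologicalSpace H] (Φ : OpenPartialHomeomorph B H) {j : A → B}
    (hj : ∀ a, j a ∈ Φ.source) (h : Topology.IsEmbedding fun a => Φ (j a)) :
    Topology.IsEmbedding j := by
  have h1 : Topology.IsEmbedding fun a => (⟨Φ (j a), Φ.map_source (hj a)⟩ : Φ.target) :=
    h.codRestrict Φ.target fun a => Φ.map_source (hj a)
  have h2 := Topology.IsEmbedding.subtypeVal.comp
    (Φ.toHomeomorphSourceTarget.symm.isEmbedding.comp h1)
  convert h2 using 1
  funext a
  exact (Φ.left_inv (hj a)).symm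

namespace ScManifold

variable {X : BanachScale.{u} ℕ} {M : Type v} [TopologicalSpace M] {𝓜 : ScManifold X M}
  {Y : BanachScale.{u} ℕ} {N : Type w} [TopologicalSpace N] {𝓢 : ScManifold Y N} {f : M → N}

/-- A map that is represented by layerwise surjective linear maps in charts is a submersion. -/
theorem isScSubmersion_of_linear (h : ∀ p : M, ∃ φ ∈ 𝓜.atlas, ∃ ψ ∈ 𝓢.atlas, p ∈ φ.source ∧
    f p ∈ ψ.source ∧ MapsTo f φ.source ψ.source ∧ ∃ L : ScLinear X Y,
      (∀ k, Function.Surjective (L.map k)) ∧ EqOn (L.map 0) (ψ ∘ f ∘ φ.symm) φ.target) :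
    𝓜.IsScSubmersion 𝓢 f := by
  have hsm : 𝓜.IsScSmoothMap 𝓢 f := by
    refine isScSmoothMap_of_charts fun q => ?_
    obtain ⟨φ, hφ, ψ, hψ, hp, hfp, hm, L, -, heq⟩ := h q
    exact ⟨φ, hφ, ψ, hψ, hp, hfp, hm, L.isScSmooth.congr φ.open_target heq⟩
  refine ⟨hsm, fun m p hp k hk => ?_⟩
  obtain ⟨φ, hφ, ψ, hψ, hpφ, hpψ, hm, L, hL, heq⟩ := h p
  have hpk := 𝓜.level_anti (Nat.succ_le_succ hk) hp
  have hp1 : p ∈ 𝓜.level 1 := 𝓜.level_anti (Nat.succ_le_succ (Nat.zero_le m)) hp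
  have hfk : f p ∈ 𝓢.level (k + 1) := by
    obtain ⟨g, -, hg⟩ := hsm.scZero (k + 1)
    have := (g ⟨p, hpk⟩).mem
    rwa [hg] at this
  let φ' : 𝓜.ChartAt p := ⟨φ, hφ, hpφ⟩
  let ψ' : 𝓢.ChartAt (f p) := ⟨ψ, hψ, hpψ⟩
  obtain ⟨e, he⟩ := 𝓜.isInvertible_chartDeriv φ' hpk
  obtain ⟨e', he'⟩ := 𝓢.isInvertible_chartDeriv ψ' hfk
  -- The layer of the derivative is `L.map k` conjugated by the chart isomorphisms, hence
  -- surjective.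
  refine ⟨(e'.symm : Y.layer k →L[ℝ] 𝓢.TangentSpace (f p) k).comp
    ((L.map k).comp (e : 𝓜.TangentSpace p k →L[ℝ] X.layer k)), ?_,
    e'.symm.surjective.comp ((hL k).comp e.surjective)⟩
  have hd : HasScDeriv X Y φ.target (ψ ∘ f ∘ φ.symm) fun _ => L.map 0 :=
    L.hasScDeriv.congr φ.open_target heq
  refine hsm.hasDerivMap hp1 φ' ψ' hm (L.isScSmooth.congr φ.open_target heq) fun v => ?_
  have h1 : scDeriv X Y φ.target (ψ ∘ f ∘ φ.symm) (X.lift 1 (φ p)) = L.map 0 :=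
    hd.scDeriv_eq (by rw [𝓜.bond_lift_one hφ hpφ hp1]; exact φ.map_source hpφ)
  change _ = scDeriv X Y φ.target (ψ ∘ f ∘ φ.symm) (X.lift 1 (φ p)) _
  rw [h1, ← he, ← he', ← L.bond_map]
  exact congrArg (Y.bond (Nat.zero_le k)) (e'.apply_symm_apply _)

end ScManifold

/-! ### Filtration, projection and fibres of the cotangent bundle -/

namespace SymplecticScManifold

variable {X : BanachScale.{u} ℤ} {ω : SymplecticForm X} {M : Type v} [TopologicalSpace M]
  {𝓜 : SymplecticScManifold ω M} [TopologicalSpace 𝓜.Cotangent]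
  {𝓣 : ScManifold ω.cotangentModel 𝓜.Cotangent} {𝓜₁ : ScManifold X.nonneg.shift (𝓜.Level 1)}

/-- The filtration of the cotangent bundle. -/
theorem mem_level_cotangent
    (h𝓣 : ∀ (φ : OpenPartialHomeomorph M (X.nonneg.layer 0)) (hφ : φ ∈ 𝓜.symplecticAtlas),
      ∃ Φ ∈ 𝓣.atlas, 𝓜.IsChartOfCotangentMap φ (𝓜.mem_atlas hφ) Φ)
    (m : ℕ) (q : 𝓜.Cotangent) (φ : 𝓜.SymplecticChartAt q.base.pt) :
    q ∈ 𝓣.level m ↔ q.base.pt ∈ 𝓜.level (m + 1) ∧ ∃ β, q.covector = 𝓜.toCovector φ m β := by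
  obtain ⟨Φ, hΦ𝓣, hΦ⟩ := h𝓣 φ.1.1 φ.2
  have hq : q.base.pt ∈ φ.1.1.source := φ.1.2.2
  have hb := 𝓜.bond_lift_one φ.1.2.1 hq q.base.mem
  -- Layer `m` of the model has first factor `X_{m+1}`, which accounts for the index shift of the
  -- base point.
  have h1 : q.base.pt ∈ 𝓜.level (m + 1) ↔ X.nonneg.lift 1 (φ.1.1 q.base.pt) ∈
      range (X.nonneg.shift.bond (Nat.zero_le m)) := by
    rw [𝓜.mem_level_iff φ.1.2.1 hq, ScManifold.mem_range_bond_shift, hb]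
  rw [𝓣.mem_level_iff hΦ𝓣 (hΦ.mem_source.2 hq), hΦ.apply, h1]
  constructor
  · rintro ⟨y, hy⟩
    have hy1 := congrArg (fun z : X.nonneg.layer 1 × (X.nonneg.layer 0 →L[ℝ] ℝ) => z.1) hy
    have hy2 := congrArg (fun z : X.nonneg.layer 1 × (X.nonneg.layer 0 →L[ℝ] ℝ) => z.2) hy
    have hr : X.nonneg.lift 1 (φ.1.1 q.base.pt) ∈ range (X.nonneg.shift.bond (Nat.zero_le m)) :=
      ⟨_, hy1⟩
    have hp := h1.2 hr
    let E := 𝓜.extDualEquiv φ hp (Int.natAbs_natCast m).le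
    refine ⟨hr, E.symm (show X.nonneg.layer (m + 1) × (X.layer (-(m : ℤ)) →L[ℝ] ℝ) from y).2, ?_⟩
    refine (𝓜.cotangentMap_toCovector q φ hp _).2 (hy2.symm.trans ?_)
    exact congrArg (ω.dual.nonneg.bond (Nat.zero_le m)) (E.apply_symm_apply _).symm
  · rintro ⟨hr, β, hβ⟩
    have hp := h1.2 hr
    obtain ⟨y, hy⟩ := hr
    exact ⟨((y, 𝓜.extDualEquiv φ hp (Int.natAbs_natCast m).le β) :
        X.nonneg.layer (m + 1) × (X.layer (-(m : ℤ)) →L[ℝ] ℝ)),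
      Prod.ext hy ((𝓜.cotangentMap_toCovector q φ hp β).1 hβ).symm⟩

/-- The zero section lifts every level, as the zero covector comes from every layer. -/
theorem surjOn_level_base
    (h𝓣 : ∀ (φ : OpenPartialHomeomorph M (X.nonneg.layer 0)) (hφ : φ ∈ 𝓜.symplecticAtlas),
      ∃ Φ ∈ 𝓣.atlas, 𝓜.IsChartOfCotangentMap φ (𝓜.mem_atlas hφ) Φ)
    (h₁ : ∀ φ ∈ 𝓜.atlas, ∃ Φ ∈ 𝓜₁.atlas, 𝓜.IsLevelChart φ 1 Φ) (m : ℕ) :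
    SurjOn (fun q : 𝓜.Cotangent => q.base) (𝓣.level m) (𝓜₁.level m) := by
  intro p hp
  obtain ⟨φ, hφ, hpφ⟩ := 𝓜.exists_symplecticChart p.pt
  refine ⟨⟨p, 0⟩, (mem_level_cotangent h𝓣 m ⟨p, 0⟩ ⟨⟨φ, 𝓜.mem_atlas hφ, hpφ⟩, hφ⟩).2
    ⟨(ScManifold.mem_level_shift h₁ p).1 hp, 0, ?_⟩, rfl⟩
  exact ContinuousLinearMap.ext fun v => rfl

/-- The projection of the cotangent bundle is an sc-smooth submersion. -/
theorem isScSubmersion_base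
    (h𝓣 : ∀ (φ : OpenPartialHomeomorph M (X.nonneg.layer 0)) (hφ : φ ∈ 𝓜.symplecticAtlas),
      ∃ Φ ∈ 𝓣.atlas, 𝓜.IsChartOfCotangentMap φ (𝓜.mem_atlas hφ) Φ)
    (h₁ : ∀ φ ∈ 𝓜.atlas, ∃ Φ ∈ 𝓜₁.atlas, 𝓜.IsLevelChart φ 1 Φ) :
    𝓣.IsScSubmersion 𝓜₁ (fun q : 𝓜.Cotangent => q.base) := by
  refine ScManifold.isScSubmersion_of_linear fun q => ?_
  obtain ⟨φ, hφ, hqφ⟩ := 𝓜.exists_symplecticChart q.base.pt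
  obtain ⟨Φ, hΦ𝓣, hΦ⟩ := h𝓣 φ hφ
  obtain ⟨Ψ, hΨ₁, hΨ⟩ := h₁ φ (𝓜.mem_atlas hφ)
  refine ⟨Φ, hΦ𝓣, Ψ, hΨ₁, hΦ.mem_source.2 hqφ, hΨ.mem_source.2 hqφ,
    fun r hr => hΨ.mem_source.2 (hΦ.mem_source.1 hr),
    ScLinear.fst X.nonneg.shift ω.dual.nonneg, fun k =>
      Prod.fst_surjective (α := X.nonneg.layer (k + 1)) (β := X.layer (-(k : ℤ)) →L[ℝ] ℝ),
    fun z hz => ?_⟩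
  have h1 := (hΦ.fst_apply (Φ.symm z)).trans (hΨ.apply (Φ.symm z).base).symm
  rw [Φ.right_inv hz] at h1
  exact h1

/-- The layers of the dual tangent scale embed into the levels of the cotangent bundle as fibres. -/
theorem exists_isEmbedding_fibre
    (h𝓣 : ∀ (φ : OpenPartialHomeomorph M (X.nonneg.layer 0)) (hφ : φ ∈ 𝓜.symplecticAtlas),
      ∃ Φ ∈ 𝓣.atlas, 𝓜.IsChartOfCotangentMap φ (𝓜.mem_atlas hφ) Φ)
    (k : ℕ) (p : 𝓜.Level 1) (φ : 𝓜.SymplecticChartAt p.pt) (hp : p.pt ∈ 𝓜.level (k + 1)) :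
    ∃ j : (𝓜.extTangent φ).dual.layer (k : ℤ) → 𝓣.Level k,
      (∀ β, (j β).pt = ⟨p, 𝓜.toCovector φ k β⟩) ∧
      Topology.IsEmbedding j ∧ Set.range j = {q | q.pt.base = p} := by
  obtain ⟨Φ, hΦ𝓣, hΦ⟩ := h𝓣 φ.1.1 φ.2
  obtain ⟨Ψ, hΨ⟩ := 𝓣.exists_isLevelChart hΦ𝓣 k
  have hpφ : p.pt ∈ φ.1.1.source := φ.1.2.2
  have hmem : ∀ β, (⟨p, 𝓜.toCovector φ k β⟩ : 𝓜.Cotangent) ∈ 𝓣.level k := fun β =>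
    (mem_level_cotangent h𝓣 k ⟨p, 𝓜.toCovector φ k β⟩ φ).2 ⟨hp, β, rfl⟩
  let j : (𝓜.ExtLayer p.pt (-(k : ℤ)) →L[ℝ] ℝ) → 𝓣.Level k := fun β => ⟨_, hmem β⟩
  have hsrc : ∀ β, j β ∈ Ψ.source := fun β => hΨ.mem_source.2 (hΦ.mem_source.2 hpφ)
  let E := 𝓜.extDualEquiv φ hp (Int.natAbs_natCast k).le
  obtain ⟨y, hy⟩ := (𝓜.mem_level_iff φ.1.2.1 hpφ).1 hp
  -- In the level chart the fibre is the slice `{y} × X_{-k}^*`, with `y` the coordinate of `p` in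
  -- `X_{k+1}`.
  have hΨj : ∀ β, Ψ (j β) = ((y, E β) : X.nonneg.layer (k + 1) × (X.layer (-(k : ℤ)) →L[ℝ] ℝ)) := by
    intro β
    refine ω.cotangentModel.bond_injective (Nat.zero_le k) ?_
    rw [hΨ.bond_apply _ (hsrc β), hΦ.apply]
    refine Prod.ext ?_ ((𝓜.cotangentMap_toCovector ⟨p, 𝓜.toCovector φ k β⟩ φ hp β).1 rfl)
    refine X.nonneg.bond_injective (Nat.zero_le 1) ?_
    refine (𝓜.bond_lift_one φ.1.2.1 hpφ p.mem).trans ?_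
    rw [← hy]
    exact (X.nonneg.bond_bond (Nat.succ_le_succ (Nat.zero_le k)) (Nat.zero_le 1) y).symm
  have hemb : Topology.IsEmbedding fun β => Ψ (j β) := by
    rw [funext hΨj]
    exact (isEmbedding_prodMkRight y).comp E.toHomeomorph.isEmbedding
  refine ⟨j, fun β => rfl, Ψ.isEmbedding_of_comp hsrc hemb, ?_⟩
  · refine Set.ext fun q => ⟨?_, ?_⟩
    · rintro ⟨β, rfl⟩
      rfl
    · obtain ⟨⟨b, c⟩, hq⟩ := q
      rintro (rfl : b = p)
      obtain ⟨-, β, hβ⟩ := (mem_level_cotangent h𝓣 k ⟨b, c⟩ φ).1 hq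
      exact ⟨β, ScManifold.Level.ext (congrArg (Cotangent.mk b) hβ.symm)⟩

end SymplecticScManifold

end

/-! ### The proposition -/

theorem mainTheorem3 {X : BanachScale.{u} ℤ} {ω : SymplecticForm X} {M : Type v}
    [TopologicalSpace M] (𝓜 : SymplecticScManifold ω M) :
    -- the manifold `M^1`, the base of the cotangent bundle
    ∃ 𝓜₁ : ScManifold X.nonneg.shift (𝓜.Level 1), 𝓜.IsShift 𝓜₁ ∧
    -- `T^*M` is an `sc^∞`-manifold modeled on `X_{≥ 0}^1 × X^*`, with charts `T^*φ`
    ∃ (_ : TopologicalSpace 𝓜.Cotangent) (𝓣 : ScManifold ω.cotangentModel 𝓜.Cotangent),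
      (∀ (φ : OpenPartialHomeomorph M (X.nonneg.layer 0)) (hφ : φ ∈ 𝓜.atlas),
        φ ∈ 𝓜.symplecticAtlas → ∃ Φ ∈ 𝓣.atlas, 𝓜.IsCotangentChart φ hφ Φ) ∧
      -- the filtration of `T^*M`
      (∀ (m : ℕ) (q : 𝓜.Cotangent) (φ : 𝓜.SymplecticChartAt q.base.pt),
        q ∈ 𝓣.level m ↔
          q.base.pt ∈ 𝓜.level (m + 1) ∧ ∃ β, q.covector = 𝓜.toCovector φ m β) ∧
      -- the bundle projection: surjective, also layer by layer, and an sc-smooth submersion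
      Function.Surjective (fun q : 𝓜.Cotangent => q.base) ∧
      (∀ m : ℕ, Set.SurjOn (fun q : 𝓜.Cotangent => q.base) (𝓣.level m) (𝓜₁.level m)) ∧
      𝓣.IsScSubmersion 𝓜₁ (fun q : 𝓜.Cotangent => q.base) ∧
      -- the scale structure of the fibre over `p ∈ M_{m+1}`, for `m` finite or `m = ∞`
      (∀ (m : ℕ∞) (p : 𝓜.Level 1) (φ : 𝓜.SymplecticChartAt p.pt),
        (∀ k : ℕ, (k : ℕ∞) ≤ m → p.pt ∈ 𝓜.level (k + 1)) →
          ((𝓜.extTangent φ).dual.restrict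
            {s : ℤ | 0 ≤ s ∧ ((s.toNat : ℕ) : ℕ∞) ≤ m}).IsBanachableScale ∧
          (∀ k : ℕ, (k : ℕ∞) ≤ m →
            ∃ j : (𝓜.extTangent φ).dual.layer (k : ℤ) → 𝓣.Level k,
              (∀ β, (j β).pt = ⟨p, 𝓜.toCovector φ k β⟩) ∧
              Topology.IsEmbedding j ∧ Set.range j = {q | q.pt.base = p}) ∧
          (∀ (k l : ℕ) (h : (l : ℤ) ≤ (k : ℤ)), (k : ℕ∞) ≤ m →
            ∀ β, 𝓜.toCovector φ l ((𝓜.extTangent φ).dual.bond h β) = 𝓜.toCovector φ k β)) := by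
  obtain ⟨𝓜₁, h₁⟩ := 𝓜.exists_shift
  let := 𝓜.cotangentTopology
  obtain ⟨𝓣, h𝓣⟩ := SymplecticScManifold.exists_scManifold_cotangent (𝓜 := 𝓜)
    fun φ hφ => 𝓜.exists_isChartOfCotangentMap hφ
  refine ⟨𝓜₁, fun φ hφ => ?_, 𝓜.cotangentTopology, 𝓣, fun φ hφ hs => ?_,
    SymplecticScManifold.mem_level_cotangent h𝓣, fun p => ⟨⟨p, 0⟩, rfl⟩,
    SymplecticScManifold.surjOn_level_base h𝓣 h₁,
    SymplecticScManifold.isScSubmersion_base h𝓣 h₁, fun m p φ hp =>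
      ⟨𝓜.isBanachableScale_extTangent_dual φ hp, fun k hk =>
        SymplecticScManifold.exists_isEmbedding_fibre h𝓣 k p φ (hp k hk), fun k l h hk β =>
        𝓜.toCovector_bond φ h (hp k hk) β⟩⟩
  · obtain ⟨Φ, hΦ₁, hΦ⟩ := h₁ φ hφ
    exact ⟨Φ, hΦ₁, hΦ.source, hΦ.bond_apply⟩
  · obtain ⟨Φ, hΦ𝓣, hΦ⟩ := h𝓣 φ hs
    exact ⟨Φ, hΦ𝓣, hΦ.isCotangentChart⟩
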